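/- Graphs are finite and may have loops and multiple edges. For a graph $G$, $d_G(v)$ is the degree of $v$ (loops count twice), and for $A\subseteq V(G)$, $e_G(A)$ is the number of edges of $G$ with both ends in $A$. A factor of $G$ is a spanning subgraph of $G$; two factors decompose $G$ if every edge of $G$ lies in exactly one of them. A bipartition of $V(G)$ is a pair $X,Y$ of disjoint (possibly empty) sets with $X\cup Y=V(G)$; edges inside $X$ or $Y$ are allowed. A graph $G$ is $m$-edge-connected if for every nonempty proper subset $A$ of $V(G)$ at least $m$ edges have exactly one end in $A$. Let $k$ be a positive integer. A mapping $f:V(G)\to \mathbb{Z}_k$ is compatible with $G$ if for every bipartition $X,Y$ of $V(G)$, either $\sum_{v\in X} f(v)-2x\equiv \sum_{v\in Y}f(v) \pmod k$ for some integer $0\le x\le e_G(X)$, or $\sum_{v\in X} f(v)\equiv \sum_{v\in Y}f(v)-2y \pmod k$ for some integer $0\le y\le e_G(Y)$. An $f$-factor of $G$ is a factor $H$ of $G$ with $d_H(v)\equiv f(v)\pmod k$ for every vertex $v$. For $X\subseteq V(T)$, an $X$-parity trail-decomposition of a graph $T$ is a partition of $E(T)$ into trails (possibly closed) such that every trail with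 an odd number of edges has exactly one of its initial and terminal vertices in $X$, and every trail with an even number of edges has both of them in $X$ or both in $V(T)\setminus X$ (so closed trails have an even number of edges). **Theorem.** Let $G$ be a graph, let $k\ge 3$ be an integer, and let $f:V(G)\to\mathbb{Z}_k$ be a mapping compatible with $G$. Let $X,Y$ be a bipartition of $V(G)$, and let $G$ be decomposed into two factors $T$ and $G_0$ such that $T$ admits an $X$-parity trail-decomposition and $e_{G_0}(X)+e_{G_0}(Y)=\min\{k-1,\ e_G(X)+e_G(Y)\}$. If $G_0$ is $(3k-3)$-edge-connected, then $G$ has an $f$-factor $H$ such that for each vertex $v$, $$\Big\lfloor \frac{d_G(v)}{2}\Big\rfloor-(k-1)\ \le\ d_H(v)\ \le\ \Big\lceil \frac{d_G(v)}{2}\Big\rceil+(k-1).$$ Furthermore, for any given vertex $z$ of odd degree in $G$, the $f$-factor $H$ can be chosen so that in addition $d_H(z)\le \lceil d_G(z)/2\rceil+(k-1)-1$. -/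

import Mathlib

/-!
Finite multigraphs (loops and parallel edges allowed) are Mathlib's `Graph α β` with finite vertex
and edge sets. A factor of `G` is a spanning subgraph (`Graph.IsSpanningSubgraph`).
-/

noncomputable section

namespace ModFactor

/-- The degree `d_G(v)`; a loop at `v` counts twice. -/
def degree {α β : Type*} (G : Graph α β) (v : α) : ℕ :=
  {e | G.IsNonloopAt e v}.ncard + 2 * {e | G.IsLoopAt e v}.ncard

/-- `e_G(A)`: the number of edges with both ends in `A` (each loop counted once). -/
def edgesInside {α β : Type*} (G : Graph α β) (A : Set α) : ℕ :=
  {e | ∃ x ∈ A, ∃ y ∈ A, G.IsLink e x y}.ncard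

/-- `d_G(A)`: the number of edges with exactly one end in `A`. -/
def cutSize {α β : Type*} (G : Graph α β) (A : Set α) : ℕ :=
  {e | ∃ x ∈ A, ∃ y ∉ A, G.IsLink e x y}.ncard

/-- `G` is `m`-edge-connected: every edge cut has at least `m` edges. -/
def EdgeConnected {α β : Type*} (G : Graph α β) (m : ℕ) : Prop :=
  ∀ A : Set α, A.Nonempty → A ⊂ G.vertexSet → m ≤ cutSize G A

/-- `X, Y` is a bipartition of the vertex set of `G` (a part may be empty, and edges inside the
parts are allowed). -/
structure IsBipartition {α β : Type*} (G : Graph α β) (X Y : Set α) : Prop where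
  union_eq : X ∪ Y = G.vertexSet
  disjoint : Disjoint X Y

/-- `f : V(G) → ℤ/k` is compatible with `G` with respect to the bipartition `X, Y`. -/
def CompatibleWith {α β : Type*} (G : Graph α β) (k : ℕ) (f : α → ZMod k) (X Y : Set α) : Prop :=
  (∃ x : ℕ, x ≤ edgesInside G X ∧ (∑ᶠ v ∈ X, f v) - 2 * (x : ZMod k) = (∑ᶠ v ∈ Y, f v)) ∨
  (∃ y : ℕ, y ≤ edgesInside G Y ∧ (∑ᶠ v ∈ X, f v) = (∑ᶠ v ∈ Y, f v) - 2 * (y : ZMod k))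

/-- `f` is compatible with `G`: it is so with respect to every bipartition of `V(G)`. -/
def Compatible {α β : Type*} (G : Graph α β) (k : ℕ) (f : α → ZMod k) : Prop :=
  ∀ X Y : Set α, IsBipartition G X Y → CompatibleWith G k f X Y

/-- A factor `H` of `G` with `d_H(v) ≡ f(v) (mod k)` at each vertex. -/
structure IsFactorMod {α β : Type*} (H G : Graph α β) (k : ℕ) (f : α → ZMod k) : Prop where
  isSpanningSubgraph : Graph.IsSpanningSubgraph H G
  degree_eq : ∀ v ∈ G.vertexSet, (degree H v : ZMod k) = f v

/-- `G` is decomposed into the two factors `G₁` and `G₂`. -/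
structure IsDecomposition {α β : Type*} (G G₁ G₂ : Graph α β) : Prop where
  left : Graph.IsSpanningSubgraph G₁ G
  right : Graph.IsSpanningSubgraph G₂ G
  union_eq : G₁.edgeSet ∪ G₂.edgeSet = G.edgeSet
  disjoint : Disjoint G₁.edgeSet G₂.edgeSet

/-- A trail: a walk without repeated edges. Vertices may repeat, and it may be closed. -/
structure Trail {α β : Type*} (G : Graph α β) where
  size : ℕ
  vert : Fin (size + 1) → α
  edge : Fin size → β
  vert_mem : ∀ i, vert i ∈ G.vertexSet
  isLink : ∀ i, G.IsLink (edge i) (vert i.castSucc) (vert i.succ)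
  edge_injective : Function.Injective edge

/-- The trails `Q 0, …, Q (n - 1)` decompose the edges of `G`. -/
def IsTrailDecomposition {α β : Type*} {G : Graph α β} {n : ℕ} (Q : Fin n → Trail G) : Prop :=
  ∀ e ∈ G.edgeSet, ∃! i, e ∈ Set.range (Q i).edge

/-- If the size is odd, exactly one of the two ends (initial and terminal vertex) lies in `X`;
if it is even, both ends lie in `X` or both lie outside `X`. In particular a closed trail, whose
ends coincide, has even size. -/
def Trail.IsParity {α β : Type*} {G : Graph α β} (P : Trail G) (X : Set α) : Prop :=
  (Odd P.size → Xor (P.vert 0 ∈ X) (P.vert (Fin.last P.size) ∈ X)) ∧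
  (Even P.size → (P.vert 0 ∈ X ↔ P.vert (Fin.last P.size) ∈ X))

/-- `G` admits an `X`-parity trail-decomposition. -/
def HasParityTrailDecomposition {α β : Type*} (G : Graph α β) (X : Set α) : Prop :=
  ∃ (n : ℕ) (Q : Fin n → Trail G), IsTrailDecomposition Q ∧ ∀ i, (Q i).IsParity X

end ModFactor

end

/-! A factor `H` is a choice of signs `h e = ±1`, positive on `H`, and the signed degree at `v` is
`2 d_H(v) - d_G(v)`. Multiply it by `σ v`, where `σ` is `1` on `X` and `-1` on `Y`. An edge between
`X` and `Y` then contributes `+1` at one end and `-1` at the other, so its sign is an orientation. A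
parity trail of `T` with alternating signs cancels at its inner vertices and acts as a single arc
between its ends. An edge of `G₀` inside `X` or `Y` contributes the same value at both ends. It is
encoded by two arcs to or from an extra root, both with the same direction, and its sign is fixed in
advance. Thus an `f`-factor is an orientation with net outdegrees prescribed modulo `2k`, and the
degree bounds amount to net outdegrees of absolute value at most `2k - 1`.

The signs inside the parts must make the total demand consistent. Compatibility supplies a suitable
integer `g`. Either all edges of `G` inside the parts lie in `G₀`, and `g` itself can be realized,
or there are `k - 1` of them in `G₀` and their partial sums cover `k` consecutive integers, hence
all residues (`exists_shift`, `exists_signs_sum_eq`). As at most `k - 1` edges are encoded this way,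
the root has degree at most `2k - 2`.

The core is the orientation theorem `Admissible.solvable`. Measure residues by `circNorm`, the
distance to `2kℤ`. The root has degree at most `2k - 2` plus the norm of the total demand, and every
cut has at least `2k - 2` plus the norm of its demand; one vertex of zero demand may be exempt.
Since the norm is at most `k`, parity derives the cut condition from `(3k-3)`-edge-connectivity.

The induction is on vertices, edges and root arcs, lexicographically. A tight set of at least two
vertices is contracted, and its inside is oriented afterwards with its complement as root
(`solvable_of_tight`). Otherwise such sets have slack two and only single vertices matter. At a
vertex of zero demand, edges are lifted (`solvable_of_target_zero`). An edge `xy` is oriented and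
deleted when this lowers the norms at both ends (`delete_arc`). If no such edge remains, all
residues lie on the same side of zero, up to reversal, and the root arcs give the room to continue
(`solvable_of_pos`).

For the refinement at `z`, only one residue permits the forbidden extreme value. In that case an
extra root arc at `z` turns the target into zero and forces a net outdegree of `±1`
(`exists_solution`). -/

/-! ### Residues modulo `2k` and their distance to zero. -/

/-- The distance from `x` to the nearest multiple of `2 * k`. -/
def circNorm (k : ℕ) (x : ℤ) : ℤ := |Int.bmod x (2 * k)|

namespace circNorm

variable {k : ℕ} {x y : ℤ}

theorem nonneg : 0 ≤ circNorm k x := abs_nonneg _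

theorem exists_rep (hk : 0 < k) (x : ℤ) :
    ∃ q r : ℤ, x = 2 * k * q + r ∧ -k ≤ r ∧ r ≤ k ∧ circNorm k x = |r| := by
  refine ⟨Int.bdiv x (2 * k), Int.bmod x (2 * k), ?_, ?_, ?_, rfl⟩
  · have := Int.bdiv_add_bmod x (2 * k)
    push_cast at this
    exact this.symm
  · have := Int.le_bmod (x := x) (m := 2 * k) (by omega)
    push_cast at this
    omega
  · have := Int.bmod_lt (x := x) (m := 2 * k) (by omega)
    push_cast at this
    omega

theorem congr (h : (2 * k : ℤ) ∣ x - y) : circNorm k x = circNorm k y := by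
  unfold circNorm
  obtain ⟨c, hc⟩ := h
  have : x = y + ((2 * k : ℕ) : ℤ) * c := by push_cast; linarith
  rw [this, Int.add_mul_bmod_self_left]

theorem eq_of_abs_le (hk : 0 < k) (h : |x| ≤ k) : circNorm k x = |x| := by
  obtain ⟨q, r, hx, h1, h2, h3⟩ := exists_rep hk x
  rw [abs_le] at h
  have hq : -1 ≤ q ∧ q ≤ 1 := by
    constructor <;> nlinarith
  rw [h3]
  obtain ⟨hq1, hq2⟩ := hq
  interval_cases q <;> grind

theorem le (hk : 0 < k) : circNorm k x ≤ k := by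
  obtain ⟨q, r, hx, h1, h2, h3⟩ := exists_rep hk x
  rw [h3, abs_le]
  omega

theorem neg (hk : 0 < k) (x : ℤ) : circNorm k (-x) = circNorm k x := by
  obtain ⟨q, r, hx, h1, h2, h3⟩ := exists_rep hk x
  rw [h3, congr (y := -r) ⟨-q, by rw [hx]; ring⟩, eq_of_abs_le hk (by rw [abs_neg, abs_le]; omega),
    abs_neg]

theorem eq_zero_iff (hk : 0 < k) : circNorm k x = 0 ↔ (2 * k : ℤ) ∣ x := by
  constructor
  · intro h
    obtain ⟨q, r, hx, h1, h2, h3⟩ := exists_rep hk x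
    rw [h3, abs_eq_zero] at h
    exact ⟨q, by rw [hx, h]; ring⟩
  · intro h
    rw [congr (y := 0) (by simpa using h), eq_of_abs_le hk (by simp)]
    simp

theorem le_abs (hk : 0 < k) : circNorm k x ≤ |x| := by
  by_cases h : |x| ≤ k
  · exact (eq_of_abs_le hk h).le
  · exact (le hk).trans (by omega)

/-- The modulus `2k` is even and an absolute value keeps parity. Cut sizes and demand norms
therefore have matching parities, and strict inequalities between them gain two. -/
theorem parity (hk : 0 < k) (x : ℤ) : (2 : ℤ) ∣ circNorm k x - x := by
  obtain ⟨q, r, hx, h1, h2, h3⟩ := exists_rep hk x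
  rw [h3, hx]
  rcases abs_cases r with ⟨h, _⟩ | ⟨h, _⟩
  · exact ⟨-(k * q), by rw [h]; ring⟩
  · exact ⟨-(k * q) - r, by rw [h]; ring⟩

theorem add_le (hk : 0 < k) (x y : ℤ) : circNorm k (x + y) ≤ circNorm k x + circNorm k y := by
  obtain ⟨q, r, hx, h1, h2, h3⟩ := exists_rep hk x
  obtain ⟨q', r', hx', h1', h2', h3'⟩ := exists_rep hk y
  rw [h3, h3', congr (y := r + r') ⟨q + q', by rw [hx, hx']; ring⟩]
  exact (le_abs hk).trans (abs_add_le _ _)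

theorem add_le_abs (hk : 0 < k) (x y : ℤ) : circNorm k (x + y) ≤ circNorm k x + |y| :=
  (add_le hk x y).trans (by have := le_abs (x := y) hk; omega)

theorem add_one (hk : 0 < k) (x : ℤ) :
    circNorm k (x + 1) = circNorm k x + 1 ∨ circNorm k (x + 1) = circNorm k x - 1 := by
  have h1 := add_le_abs hk x 1
  have h2 := add_le_abs hk (x + 1) (-1)
  have h3 := parity hk x
  have h4 := parity hk (x + 1)
  simp only [add_neg_cancel_right, abs_neg, abs_one] at h1 h2
  omega

theorem sub_one (hk : 0 < k) (x : ℤ) :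
    circNorm k (x - 1) = circNorm k x + 1 ∨ circNorm k (x - 1) = circNorm k x - 1 := by
  have := add_one hk (x - 1)
  rw [sub_add_cancel] at this
  omega

/-- A nonzero residue gets closer to zero in one of the two directions. -/
theorem sub_one_or_add_one (hk : 0 < k) (h : circNorm k x ≠ 0) :
    circNorm k (x - 1) = circNorm k x - 1 ∨ circNorm k (x + 1) = circNorm k x - 1 := by
  obtain ⟨q, r, hx, h1, h2, h3⟩ := exists_rep hk x
  rw [h3] at h ⊢
  rw [congr (x := x - 1) (y := r - 1) ⟨q, by rw [hx]; ring⟩,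
    congr (x := x + 1) (y := r + 1) ⟨q, by rw [hx]; ring⟩]
  have hr : r ≠ 0 := by simpa using h
  rcases lt_or_gt_of_ne hr with hr | hr
  · right
    rw [eq_of_abs_le hk (by rw [abs_le]; omega)]
    grind
  · left
    rw [eq_of_abs_le hk (by rw [abs_le]; omega)]
    grind

/-- If only subtracting one decreases the norm, the residue is a positive number below `k`. -/
theorem congr_self (hk : 0 < k) (h : circNorm k (x - 1) = circNorm k x - 1)
    (h' : circNorm k (x + 1) ≠ circNorm k x - 1) :
    (2 * k : ℤ) ∣ x - circNorm k x ∧ circNorm k x < k ∧ 1 ≤ circNorm k x := by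
  have h0 := nonneg (k := k) (x := x - 1)
  obtain ⟨q, r, hx, h1, h2, h3⟩ := exists_rep hk x
  rw [h3] at h h' ⊢
  rw [congr (x := x - 1) (y := r - 1) ⟨q, by rw [hx]; ring⟩] at h
  rw [congr (x := x + 1) (y := r + 1) ⟨q, by rw [hx]; ring⟩] at h'
  have hr0 : |r| ≠ 0 := by rw [congr (x := x - 1) (y := r - 1) ⟨q, by rw [hx]; ring⟩] at h0; omega
  -- At the antipode `k` both directions lead closer to zero, contrary to `h'`.
  have hr1 : r ≠ k := by
    rintro rfl
    apply h'
    rw [congr (y := (k : ℤ) + 1 - 2 * k) ⟨1, by ring⟩, eq_of_abs_le hk (by grind)]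
    grind
  have hr2 : 0 ≤ r := by
    by_contra hr
    apply h'
    rw [eq_of_abs_le hk (by grind)]
    grind
  rw [abs_of_nonneg hr2] at *
  exact ⟨⟨q, by rw [hx]; ring⟩, by omega, by omega⟩

/-- An integer bounded by the degree of a tight vertex is less than `2 * k` in absolute value. -/
theorem abs_le_of_abs_le_add {n : ℤ} (hk : 0 < k) (hn : (2 * k : ℤ) ∣ n - x)
    (h : |n| ≤ 2 * k - 2 + circNorm k x) : |n| ≤ 2 * k - 1 := by
  -- If `|n| ≥ 2k`, moving `n` by `2k` towards zero shows that its norm is at most `|n| - 2k`. The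
  -- hypothesis then gives `|n| ≤ |n| - 2`. This is what the constant `2k - 2` in the degree
  -- conditions is for.
  by_contra hc
  rw [← congr hn] at h
  rcases abs_cases n with ⟨h1, h2⟩ | ⟨h1, h2⟩
  · have h3 := le_abs (x := n - 2 * k) hk
    rw [congr (x := n) (y := n - 2 * k) ⟨1, by ring⟩] at h
    grind
  · have h3 := le_abs (x := n + 2 * k) hk
    rw [congr (x := n) (y := n + 2 * k) ⟨-1, by ring⟩] at h
    grind

theorem abs_le_of_ne_zero {n : ℤ} (hk : 0 < k) (hn : (2 * k : ℤ) ∣ n - x)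
    (hx : circNorm k x ≠ 0) (h : |n| ≤ 2 * k) : |n| ≤ 2 * k - 1 := by
  by_contra hc
  apply hx
  rw [← congr hn, eq_zero_iff hk]
  rcases abs_cases n with ⟨h1, h2⟩ | ⟨h1, h2⟩
  · exact ⟨1, by omega⟩
  · exact ⟨-1, by omega⟩

end circNorm

/-- Elements with equal images can be matched one by one. It serves to pull an orientation of a
contracted graph back to the original edges. -/
theorem Multiset.exists_pullback {X Y Z W : Type*} {f : X → Z} {g : Y → Z} {p : W → X} {q : W → Y}
    (hw : ∀ x y, f x = g y → ∃ w, p w = x ∧ q w = y) (t : Multiset Y) :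
    ∀ s : Multiset X, s.map f = t.map g → ∃ u : Multiset W, u.map p = s ∧ u.map q = t := by
  induction t using Multiset.induction with
  | empty =>
    intro s hs
    refine ⟨0, ?_, rfl⟩
    simpa [eq_comm] using hs
  | cons y t ih =>
    intro s hs
    rw [Multiset.map_cons] at hs
    obtain ⟨x, hx, hxy⟩ : ∃ x ∈ s, f x = g y := by
      rw [← Multiset.mem_map, hs]
      exact Multiset.mem_cons_self _ _
    obtain ⟨s, rfl⟩ := Multiset.exists_cons_of_mem hx
    rw [Multiset.map_cons, hxy, Multiset.cons_inj_right] at hs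
    obtain ⟨u, rfl, rfl⟩ := ih s hs
    obtain ⟨w, rfl, rfl⟩ := hw x y hxy
    exact ⟨w ::ₘ u, by simp, by simp⟩

/-! ### Multigraphs as multisets of edges and arcs: cuts and net outdegrees. -/

section RootedGraphs

set_option linter.unusedSectionVars false

variable {V : Type*} [DecidableEq V]

/-- The indicator of membership in `A`. -/
def ind (A : Finset V) (v : V) : ℤ := if v ∈ A then 1 else 0

/-- The indicator of the edges with exactly one end in `A`. -/
def crossing (A : Finset V) : Sym2 V → ℤ :=
  Sym2.lift ⟨fun x y ↦ |ind A x - ind A y|, fun _ _ ↦ abs_sub_comm _ _⟩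

/-- The number of edges in `E` with exactly one end in `A`. -/
def cut (E : Multiset (Sym2 V)) (A : Finset V) : ℤ := (E.map (crossing A)).sum

/-- The number of elements of `I` that lie in `A`. -/
def mass (I : Multiset V) (A : Finset V) : ℤ := (I.map (ind A)).sum

/-- The number of arcs of `D` leaving `A` minus the number of arcs entering `A`. -/
def net (D : Multiset (V × V)) (A : Finset V) : ℤ := (D.map fun p ↦ ind A p.1 - ind A p.2).sum

theorem ind_of_mem {A : Finset V} {v : V} (h : v ∈ A) : ind A v = 1 := if_pos h

theorem ind_of_notMem {A : Finset V} {v : V} (h : v ∉ A) : ind A v = 0 := if_neg h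

theorem ind_eq (A : Finset V) (v : V) : ind A v = if v ∈ A then 1 else 0 := rfl

@[simp] theorem crossing_mk (A : Finset V) (x y : V) : crossing A s(x, y) = |ind A x - ind A y| :=
  rfl

@[simp] theorem cut_zero (A : Finset V) : cut 0 A = 0 := rfl

@[simp] theorem cut_cons (e : Sym2 V) (E : Multiset (Sym2 V)) (A : Finset V) :
    cut (e ::ₘ E) A = crossing A e + cut E A := by simp [cut]

@[simp] theorem mass_zero (A : Finset V) : mass 0 A = 0 := rfl

@[simp] theorem mass_cons (v : V) (I : Multiset V) (A : Finset V) :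
    mass (v ::ₘ I) A = ind A v + mass I A := by simp [mass]

@[simp] theorem mass_add (I J : Multiset V) (A : Finset V) :
    mass (I + J) A = mass I A + mass J A := by simp [mass]

@[simp] theorem mass_replicate (n : ℕ) (v : V) (A : Finset V) :
    mass (Multiset.replicate n v) A = n * ind A v := by simp [mass]

@[simp] theorem net_zero (A : Finset V) : net 0 A = 0 := rfl

@[simp] theorem net_cons (p : V × V) (D : Multiset (V × V)) (A : Finset V) :
    net (p ::ₘ D) A = ind A p.1 - ind A p.2 + net D A := by simp [net]

@[simp] theorem net_add (D F : Multiset (V × V)) (A : Finset V) :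
    net (D + F) A = net D A + net F A := by simp [net]

theorem ind_nonneg (A : Finset V) (v : V) : 0 ≤ ind A v := by
  rw [ind_eq]; split_ifs <;> simp

theorem crossing_nonneg (A : Finset V) (e : Sym2 V) : 0 ≤ crossing A e := by
  induction e with | _ x y => exact abs_nonneg _

theorem cut_nonneg (E : Multiset (Sym2 V)) (A : Finset V) : 0 ≤ cut E A :=
  Multiset.sum_nonneg fun _ h ↦ by
    obtain ⟨e, -, rfl⟩ := Multiset.mem_map.1 h
    exact crossing_nonneg A e

theorem mass_nonneg (I : Multiset V) (A : Finset V) : 0 ≤ mass I A :=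
  Multiset.sum_nonneg fun _ h ↦ by
    obtain ⟨e, -, rfl⟩ := Multiset.mem_map.1 h
    exact ind_nonneg A e

theorem ind_union {A B : Finset V} (h : Disjoint A B) (v : V) :
    ind (A ∪ B) v = ind A v + ind B v := by
  have hv : v ∈ A → v ∉ B := fun h' ↦ Finset.disjoint_left.1 h h'
  simp only [ind_eq, Finset.mem_union]
  split_ifs <;> simp_all

theorem mass_union {A B : Finset V} (h : Disjoint A B) (I : Multiset V) :
    mass I (A ∪ B) = mass I A + mass I B := by
  induction I using Multiset.induction with
  | empty => simp
  | cons v I ih => simp only [mass_cons, ih, ind_union h]; ring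

theorem net_union {A B : Finset V} (h : Disjoint A B) (D : Multiset (V × V)) :
    net D (A ∪ B) = net D A + net D B := by
  induction D using Multiset.induction with
  | empty => simp
  | cons v I ih => simp only [net_cons, ih, ind_union h]; ring

theorem ind_eq_sum (A : Finset V) (v : V) : ind A v = ∑ a ∈ A, ind {a} v := by
  simp [ind_eq]

theorem mass_eq_sum (A : Finset V) (I : Multiset V) : mass I A = ∑ a ∈ A, mass I {a} := by
  induction I using Multiset.induction with
  | empty => simp
  | cons v I ih => simp only [mass_cons, ih, Finset.sum_add_distrib, ← ind_eq_sum]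

theorem net_eq_sum (A : Finset V) (D : Multiset (V × V)) : net D A = ∑ a ∈ A, net D {a} := by
  induction D using Multiset.induction with
  | empty => simp
  | cons v I ih =>
    simp only [net_cons, ih, Finset.sum_add_distrib, Finset.sum_sub_distrib, ← ind_eq_sum]

/-- The multiset of edges underlying a multiset of arcs. -/
def underlying (D : Multiset (V × V)) : Multiset (Sym2 V) := D.map fun p ↦ s(p.1, p.2)

@[simp] theorem underlying_zero : underlying (0 : Multiset (V × V)) = 0 := rfl

@[simp] theorem underlying_cons (p : V × V) (D : Multiset (V × V)) :
    underlying (p ::ₘ D) = s(p.1, p.2) ::ₘ underlying D := by simp [underlying]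

@[simp] theorem underlying_add (D F : Multiset (V × V)) :
    underlying (D + F) = underlying D + underlying F := by simp [underlying]

theorem exists_underlying_eq (E : Multiset (Sym2 V)) : ∃ D, underlying D = E := by
  induction E using Multiset.induction with
  | empty => exact ⟨0, rfl⟩
  | cons e E ih =>
    obtain ⟨D, rfl⟩ := ih
    induction e with | _ x y => exact ⟨(x, y) ::ₘ D, by simp⟩

/-- Each arc contributes to the net outdegree the crossing indicator of its edge up to sign. -/
theorem net_parity (D : Multiset (V × V)) (A : Finset V) :
    (2 : ℤ) ∣ net D A - cut (underlying D) A := by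
  induction D using Multiset.induction with
  | empty => simp
  | cons p D ih =>
    simp only [net_cons, underlying_cons, cut_cons, crossing_mk, ind_eq]
    split_ifs <;> norm_num <;> omega

/-- Every net outdegree of `A` within the evident bounds and of the right parity is attained. -/
theorem exists_net_eq (E : Multiset (Sym2 V)) (A : Finset V) :
    ∀ s : ℤ, |s| ≤ cut E A → (2 : ℤ) ∣ s - cut E A → ∃ D, underlying D = E ∧ net D A = s := by
  induction E using Multiset.induction with
  | empty =>
    intro s hs _
    exact ⟨0, rfl, by simpa [eq_comm] using hs⟩
  | cons e E ih =>
    induction e with | _ x y =>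
    intro s hs hp
    have key : ∀ t : ℤ, (t = ind A x - ind A y ∨ t = ind A y - ind A x) → |s - t| ≤ cut E A →
        (2 : ℤ) ∣ s - t - cut E A → ∃ D, underlying D = s(x, y) ::ₘ E ∧ net D A = s := by
      intro t ht h1 h2
      obtain ⟨D, hD, hs⟩ := ih _ h1 h2
      rcases ht with rfl | rfl
      · exact ⟨(x, y) ::ₘ D, by simp [hD], by simp [hs]⟩
      · exact ⟨(y, x) ::ₘ D, by simp [hD, Sym2.eq_swap], by simp [hs]⟩
    simp only [cut_cons, crossing_mk] at hs hp
    rcases le_or_gt s 0 with h | h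
    · refine key (-|ind A x - ind A y|) ?_ ?_ ?_
      · rcases abs_cases (ind A x - ind A y) with ⟨h, _⟩ | ⟨h, _⟩ <;> omega
      · have := cut_nonneg E A
        simp only [ind_eq] at *
        split_ifs at * <;> norm_num at * <;> rw [abs_le] at * <;> omega
      · omega
    · refine key |ind A x - ind A y| ?_ ?_ ?_
      · rcases abs_cases (ind A x - ind A y) with ⟨h, _⟩ | ⟨h, _⟩ <;> omega
      · have := cut_nonneg E A
        simp only [ind_eq] at *
        split_ifs at * <;> norm_num at * <;> rw [abs_le] at * <;> omega
      · omega

theorem cut_eq_zero {E : Multiset (Sym2 V)} {A : Finset V}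
    (h : ∀ x y, s(x, y) ∈ E → x ∈ A → y ∈ A) : cut E A = 0 := by
  apply Multiset.sum_eq_zero
  intro c hc
  obtain ⟨e, he, rfl⟩ := Multiset.mem_map.1 hc
  induction e with | _ x y =>
  have h1 := h x y he
  have h2 := h y x (Sym2.eq_swap ▸ he)
  simp only [crossing_mk, ind_eq]
  split_ifs <;> simp_all

theorem exists_crossing {E : Multiset (Sym2 V)} {A : Finset V} (h : 0 < cut E A) :
    ∃ x y, s(x, y) ∈ E ∧ x ∈ A ∧ y ∉ A := by
  by_contra! hc
  rw [cut_eq_zero hc] at h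
  exact lt_irrefl _ h

theorem cut_compl {E : Multiset (Sym2 V)} {A B W : Finset V} (h : ∀ e ∈ E, ∀ v ∈ e, v ∈ W)
    (hAB : ∀ v ∈ W, v ∈ A ↔ v ∉ B) : cut E A = cut E B := by
  unfold cut
  congr 1
  refine Multiset.map_congr rfl fun e he ↦ ?_
  have := h e he
  induction e with | _ x y =>
  have h1 := hAB x (this x (by simp))
  have h2 := hAB y (this y (by simp))
  simp only [crossing_mk, ind_eq]
  split_ifs <;> simp_all

/-! ### Rooted graphs with prescribed net outdegrees. -/

/-- A multigraph with a root, described by its non-root vertices and edges, the heads of the arcs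
leaving the root, the tails of the arcs entering the root, and a prescribed net outdegree at each
non-root vertex. -/
structure RootedGraph (V : Type*) where
  verts : Finset V
  edges : Multiset (Sym2 V)
  inn : Multiset V
  out : Multiset V
  target : V → ℤ

namespace RootedGraph

variable (P : RootedGraph V) (k : ℕ)

/-- The number of edges leaving the vertex set `A`. -/
def deg (A : Finset V) : ℤ := cut P.edges A + mass P.inn A + mass P.out A

/-- The number of edges between `A` and the root. -/
def rdeg (A : Finset V) : ℤ := mass P.inn A + mass P.out A

/-- The net number of arcs from `A` to the root. -/
def rootNet (A : Finset V) : ℤ := mass P.out A - mass P.inn A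

/-- The prescribed net outdegree of `A`. -/
def demand (A : Finset V) : ℤ := ∑ v ∈ A, P.target v

/-- The degree conditions that guarantee an orientation; `v₀` is a vertex that may violate the
cut condition if its target is zero. -/
structure Admissible (v₀ : V) : Prop where
  edges_mem : ∀ e ∈ P.edges, ∀ v ∈ e, v ∈ P.verts
  parity : ∀ A ⊆ P.verts, (2 : ℤ) ∣ P.demand A - P.deg A
  sum : (2 * k : ℤ) ∣ P.demand P.verts - P.rootNet P.verts
  root : P.rdeg P.verts ≤ 2 * k - 2 + circNorm k (P.demand P.verts)
  cut : ∀ A ⊆ P.verts, A.Nonempty → A ≠ P.verts →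
    2 * k - 2 + circNorm k (P.demand A) ≤ P.deg A ∨ (A = {v₀} ∧ circNorm k (P.target v₀) = 0)

/-- There is an orientation with the prescribed net outdegrees modulo `2 * k`, all of which are
less than `2 * k` in absolute value. -/
def Solvable : Prop :=
  ∃ D : Multiset (V × V), underlying D = P.edges ∧ ∀ v ∈ P.verts,
    (2 * k : ℤ) ∣ net D {v} + P.rootNet {v} - P.target v ∧ |net D {v} + P.rootNet {v}| ≤ 2 * k - 1

variable {P k}

theorem demand_singleton (v : V) : P.demand {v} = P.target v := by simp [demand]

theorem demand_union {A B : Finset V} (h : Disjoint A B) :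
    P.demand (A ∪ B) = P.demand A + P.demand B := Finset.sum_union h

theorem rdeg_nonneg (A : Finset V) : 0 ≤ P.rdeg A := add_nonneg (mass_nonneg _ _) (mass_nonneg _ _)

theorem deg_eq (A : Finset V) : P.deg A = cut P.edges A + P.rdeg A := by
  unfold deg rdeg; ring

theorem rdeg_union {A B : Finset V} (h : Disjoint A B) :
    P.rdeg (A ∪ B) = P.rdeg A + P.rdeg B := by
  simp only [rdeg, mass_union h]; ring

/-- The same multigraph with all arcs and all targets reversed. -/
def reverse (P : RootedGraph V) : RootedGraph V :=
  ⟨P.verts, P.edges, P.out, P.inn, fun v ↦ -P.target v⟩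

theorem reverse_demand (A : Finset V) : P.reverse.demand A = -P.demand A := by
  simp [demand, reverse]

theorem reverse_deg (A : Finset V) : P.reverse.deg A = P.deg A := by
  simp only [deg, reverse]; ring

theorem reverse_rootNet (A : Finset V) : P.reverse.rootNet A = -P.rootNet A := by
  simp [rootNet, reverse]

theorem reverse_rdeg (A : Finset V) : P.reverse.rdeg A = P.rdeg A := add_comm _ _

theorem Admissible.reverse {v₀ : V} (hk : 0 < k) (h : P.Admissible k v₀) :
    P.reverse.Admissible k v₀ where
  edges_mem := h.edges_mem
  parity A hA := by
    have := h.parity A hA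
    rw [reverse_demand, reverse_deg]
    omega
  sum := by
    rw [reverse_demand, reverse_rootNet]
    obtain ⟨c, hc⟩ := h.sum
    refine ⟨-c, ?_⟩
    change -P.demand P.verts - -P.rootNet P.verts = _
    linear_combination -hc
  root := by
    rw [reverse_demand, circNorm.neg hk, reverse_rdeg]
    exact h.root
  cut A := by
    rw [reverse_demand, circNorm.neg hk, reverse_deg]
    simp only [RootedGraph.reverse, circNorm.neg hk]
    exact h.cut A

theorem net_map_swap (D : Multiset (V × V)) (A : Finset V) : net (D.map Prod.swap) A = -net D A := by
  induction D using Multiset.induction with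
  | empty => simp
  | cons p D ih => simp only [Multiset.map_cons, net_cons, ih, Prod.fst_swap, Prod.snd_swap]; ring

theorem underlying_map_swap (D : Multiset (V × V)) :
    underlying (D.map Prod.swap) = underlying D := by
  induction D using Multiset.induction with
  | empty => simp
  | cons p D ih =>
    simp only [Multiset.map_cons, underlying_cons, ih, Prod.fst_swap, Prod.snd_swap]
    rw [Sym2.eq_swap]

theorem Solvable.of_reverse (h : P.reverse.Solvable k) : P.Solvable k := by
  obtain ⟨D, hD, h⟩ := h
  refine ⟨D.map Prod.swap, by rw [underlying_map_swap]; exact hD, fun v hv ↦ ?_⟩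
  obtain ⟨h1, h2⟩ := h v hv
  have e : net (D.map Prod.swap) {v} + P.rootNet {v} = -(net D {v} + P.reverse.rootNet {v}) := by
    rw [net_map_swap, reverse_rootNet]
    ring
  rw [e, abs_neg]
  refine ⟨?_, h2⟩
  obtain ⟨c, hc⟩ := h1
  change _ - -P.target v = _ at hc
  exact ⟨-c, by linear_combination -hc⟩

end RootedGraph

end RootedGraphs

/-! ### Local reductions: deleting, lifting and rerouting edges. -/

section RootedGraphs

set_option linter.unusedSectionVars false

variable {V : Type*} [DecidableEq V]

namespace RootedGraph

variable {P : RootedGraph V} {k : ℕ}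

theorem ind_singleton_comm (v x : V) : ind {v} x = ind {x} v := by
  simp [ind_eq, eq_comm]

theorem ind_singleton_self (v : V) : ind {v} v = 1 := by simp [ind_eq]

theorem ind_singleton_of_ne {v x : V} (h : x ≠ v) : ind {v} x = 0 := by simp [ind_eq, h]

/-- Replace the edges and the root arcs, add `c` to the target of `x` and `d` to that of `y`. -/
def modify (P : RootedGraph V) (E : Multiset (Sym2 V)) (I O : Multiset V) (x y : V) (c d : ℤ) :
    RootedGraph V :=
  ⟨P.verts, E, I, O, fun v ↦ P.target v + (c * ind {v} x + d * ind {v} y)⟩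

variable {E : Multiset (Sym2 V)} {I O : Multiset V} {x y : V} {c d : ℤ}

theorem modify_demand (A : Finset V) :
    (P.modify E I O x y c d).demand A = P.demand A + (c * ind A x + d * ind A y) := by
  simp only [demand, modify, Finset.sum_add_distrib, ← Finset.mul_sum, ind_eq_sum A,
    ind_singleton_comm]

theorem modify_deg (A : Finset V) :
    (P.modify E I O x y c d).deg A = _root_.cut E A + mass I A + mass O A := rfl

theorem modify_rdeg (A : Finset V) :
    (P.modify E I O x y c d).rdeg A = mass I A + mass O A := rfl

theorem modify_rootNet (A : Finset V) :
    (P.modify E I O x y c d).rootNet A = mass O A - mass I A := rfl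

/-- All sets of at least two vertices satisfy the cut condition with room to spare. -/
def StrictCuts (P : RootedGraph V) (k : ℕ) : Prop :=
  ∀ A ⊆ P.verts, 2 ≤ A.card → A ≠ P.verts → 2 * k + circNorm k (P.demand A) ≤ P.deg A

/-- The norm is 1-Lipschitz, so the slack of two given by `StrictCuts` absorbs the changes of degree
and demand on every larger set (`hcut`). Only single vertices need an individual check (`hcut1`),
and the exempt vertex may change from `v₀` to `v₁`. -/
theorem Admissible.modify {v₀ v₁ : V} (hk : 0 < k) (h : P.Admissible k v₀) (hs : P.StrictCuts k)
    (he : ∀ e ∈ E, ∀ v ∈ e, v ∈ P.verts)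
    (hpar : ∀ A ⊆ P.verts, (2 : ℤ) ∣ c * ind A x + d * ind A y -
      ((_root_.cut E A + mass I A + mass O A) - P.deg A))
    (hsum : c * ind P.verts x + d * ind P.verts y =
      mass O P.verts - mass I P.verts - P.rootNet P.verts)
    (hroot : mass I P.verts + mass O P.verts ≤ 2 * k - 2 +
      circNorm k (P.demand P.verts + (c * ind P.verts x + d * ind P.verts y)))
    (hcut : ∀ A ⊆ P.verts, |c * ind A x + d * ind A y| ≤
      2 + (_root_.cut E A + mass I A + mass O A) - P.deg A)
    (hcut1 : ∀ v ∈ P.verts, 2 * k - 2 +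
      circNorm k (P.target v + (c * ind {v} x + d * ind {v} y)) ≤
        _root_.cut E {v} + mass I {v} + mass O {v} ∨
      v = v₁ ∧ circNorm k (P.target v + (c * ind {v} x + d * ind {v} y)) = 0) :
    (P.modify E I O x y c d).Admissible k v₁ where
  edges_mem := he
  parity A hA := by
    rw [modify_demand, modify_deg]
    have := hpar A hA
    have := h.parity A hA
    omega
  sum := by
    obtain ⟨q, hq⟩ := h.sum
    refine ⟨q, ?_⟩
    rw [modify_demand, modify_rootNet]
    change P.demand P.verts + (c * ind P.verts x + d * ind P.verts y) -
      (mass O P.verts - mass I P.verts) = _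
    linarith
  root := by
    rw [modify_demand, modify_rdeg]
    exact hroot
  cut A hA hne hA' := by
    rw [modify_demand, modify_deg]
    by_cases h2 : 2 ≤ A.card
    · have h3 := hs A hA h2 hA'
      have h4 := hcut A hA
      have h5 := circNorm.add_le_abs hk (P.demand A) (c * ind A x + d * ind A y)
      left
      omega
    · obtain ⟨v, rfl⟩ : ∃ v, A = {v} := by
        rw [← Finset.card_eq_one]
        have := hne.card_pos
        omega
      rw [demand_singleton]
      refine (hcut1 v (hA (by simp))).imp id ?_
      rintro ⟨rfl, h⟩
      exact ⟨rfl, h⟩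

/-- An orientation of the modified graph is translated back by `hD`, with the change of target
compensated. The congruence is automatic; `hb` is there because the bound `2k - 1` could be lost in
the translation. -/
theorem Solvable.of_modify
    (hD : ∀ D, underlying D = E → ∃ D', underlying D' = P.edges ∧ ∀ v,
      net D' {v} + P.rootNet {v} = net D {v} + (mass O {v} - mass I {v}) -
        (c * ind {v} x + d * ind {v} y))
    (hb : ∀ v ∈ P.verts, ∀ N : ℤ, (2 * k : ℤ) ∣ N - P.target v →
      |N + (c * ind {v} x + d * ind {v} y)| ≤ 2 * k - 1 → |N| ≤ 2 * k - 1)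
    (h : (P.modify E I O x y c d).Solvable k) : P.Solvable k := by
  obtain ⟨D, h1, h2⟩ := h
  obtain ⟨D', h3, h4⟩ := hD D h1
  refine ⟨D', h3, fun v hv ↦ ?_⟩
  obtain ⟨h5, h6⟩ := h2 v hv
  have h7 := h4 v
  rw [modify_rootNet] at h5 h6
  change _ ∣ _ - (P.target v + (c * ind {v} x + d * ind {v} y)) at h5
  have h8 : (2 * k : ℤ) ∣ net D' {v} + P.rootNet {v} - P.target v := by
    rw [h7]
    convert h5 using 1
    ring
  refine ⟨h8, hb v hv _ h8 ?_⟩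
  rw [h7]
  convert h6 using 2
  ring

/-- Targets of nonzero norm may be changed by one. -/
theorem abs_le_of_abs_add_le {v : V} (hk : 0 < k) (hx : c ≠ 0 → circNorm k (P.target x) ≠ 0)
    (hy : d ≠ 0 → circNorm k (P.target y) ≠ 0) (hc : |c| ≤ 1) (hd : |d| ≤ 1) (hxy : x ≠ y) (N : ℤ)
    (hN : (2 * k : ℤ) ∣ N - P.target v)
    (h : |N + (c * ind {v} x + d * ind {v} y)| ≤ 2 * k - 1) : |N| ≤ 2 * k - 1 := by
  rw [abs_le] at hc hd
  by_cases hvx : v = x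
  · subst hvx
    rw [ind_singleton_self, ind_singleton_of_ne hxy.symm] at h
    by_cases hc0 : c = 0
    · simpa [hc0] using h
    · refine circNorm.abs_le_of_ne_zero hk hN (hx hc0) ?_
      rw [abs_le] at h ⊢
      omega
  by_cases hvy : v = y
  · subst hvy
    rw [ind_singleton_self, ind_singleton_of_ne hxy] at h
    by_cases hc0 : d = 0
    · simpa [hc0] using h
    · refine circNorm.abs_le_of_ne_zero hk hN (hy hc0) ?_
      rw [abs_le] at h ⊢
      omega
  · rw [ind_singleton_of_ne (Ne.symm hvx), ind_singleton_of_ne (Ne.symm hvy)] at h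
    simpa using h

/-- Orient an edge `xy` from `x` to `y` and delete it. -/
theorem delete_arc {v₀ : V} (hk : 0 < k) (h : P.Admissible k v₀) (hs : P.StrictCuts k)
    (h1 : ∀ v ∈ P.verts, 2 * k - 2 + circNorm k (P.target v) ≤ P.deg {v})
    (hE : P.edges = s(x, y) ::ₘ E) (hxy : x ≠ y)
    (hx : circNorm k (P.target x - 1) = circNorm k (P.target x) - 1)
    (hy : circNorm k (P.target y + 1) = circNorm k (P.target y) - 1) :
    (P.modify E P.inn P.out x y (-1) 1).Admissible k v₀ ∧
      ((P.modify E P.inn P.out x y (-1) 1).Solvable k → P.Solvable k) := by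
  have hxW : x ∈ P.verts := h.edges_mem s(x, y) (by simp [hE]) x (by simp)
  have hyW : y ∈ P.verts := h.edges_mem s(x, y) (by simp [hE]) y (by simp)
  refine ⟨h.modify hk hs ?_ ?_ ?_ ?_ ?_ ?_, Solvable.of_modify ?_ ?_⟩
  · exact fun e he ↦ h.edges_mem e (by simp [hE, he])
  · intro A hA
    simp only [deg, hE, cut_cons, crossing_mk, ind_eq]
    split_ifs <;> norm_num
  · rw [ind_of_mem hxW, ind_of_mem hyW, rootNet]
    ring
  · rw [ind_of_mem hxW, ind_of_mem hyW]
    have := h.root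
    simpa [rdeg] using this
  · intro A hA
    simp only [deg, hE, cut_cons, crossing_mk, ind_eq]
    split_ifs <;> norm_num <;> omega
  · intro v hv
    left
    have := h1 v hv
    simp only [deg, hE, cut_cons, crossing_mk] at this
    by_cases hvx : v = x
    · subst hvx
      rw [ind_singleton_self, ind_singleton_of_ne hxy.symm] at *
      norm_num at *
      rw [← sub_eq_add_neg, hx]
      omega
    by_cases hvy : v = y
    · subst hvy
      rw [ind_singleton_self, ind_singleton_of_ne hxy] at *
      norm_num at *
      rw [hy]
      omega
    · rw [ind_singleton_of_ne (Ne.symm hvx), ind_singleton_of_ne (Ne.symm hvy)] at *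
      norm_num at *
      omega
  · intro D hD
    refine ⟨(x, y) ::ₘ D, by simp [hD, hE], fun v ↦ ?_⟩
    simp only [net_cons, rootNet]
    ring
  · intro v hv
    have h2 := circNorm.nonneg (k := k) (x := P.target x - 1)
    have h3 := circNorm.nonneg (k := k) (x := P.target y + 1)
    exact abs_le_of_abs_add_le hk (fun _ ↦ by omega) (fun _ ↦ by omega) (by simp) (by simp) hxy

/-- Lift an edge `xu` and a root arc at `x` to a root arc at `u`. -/
theorem lift_root {v₀ u : V} (hk : 0 < k) (h : P.Admissible k v₀) (hs : P.StrictCuts k)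
    (h1 : ∀ v ∈ P.verts, v ≠ x → 2 * k - 2 + circNorm k (P.target v) ≤ P.deg {v})
    (hx : circNorm k (P.target x) = 0 ∨ 2 * k + circNorm k (P.target x) ≤ P.deg {x})
    (hE : P.edges = s(x, u) ::ₘ E) (hxu : x ≠ u) (hI : P.inn = x ::ₘ I) :
    (P.modify E (u ::ₘ I) P.out x u 0 0).Admissible k x ∧
      ((P.modify E (u ::ₘ I) P.out x u 0 0).Solvable k → P.Solvable k) := by
  have hxW : x ∈ P.verts := h.edges_mem s(x, u) (by simp [hE]) x (by simp)
  have huW : u ∈ P.verts := h.edges_mem s(x, u) (by simp [hE]) u (by simp)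
  refine ⟨h.modify hk hs ?_ ?_ ?_ ?_ ?_ ?_, Solvable.of_modify ?_ ?_⟩
  · exact fun e he ↦ h.edges_mem e (by simp [hE, he])
  · intro A hA
    simp only [deg, hE, hI, cut_cons, mass_cons, crossing_mk, ind_eq]
    split_ifs <;> norm_num <;> omega
  · simp only [rootNet, hI, mass_cons, ind_of_mem hxW, ind_of_mem huW]
    ring
  · have := h.root
    simp only [rdeg, hI, mass_cons, ind_of_mem hxW] at this
    simpa [ind_of_mem huW] using this
  · intro A hA
    simp only [deg, hE, hI, cut_cons, mass_cons, crossing_mk, ind_eq]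
    split_ifs <;> norm_num <;> omega
  · intro v hv
    by_cases hvx : v = x
    · subst hvx
      rcases hx with hx | hx
      · right
        simpa using hx
      · left
        simp only [deg, hE, hI, cut_cons, mass_cons, crossing_mk] at hx
        rw [ind_singleton_self, ind_singleton_of_ne hxu.symm] at *
        simp only [mass_cons, ind_singleton_of_ne hxu.symm]
        norm_num at *
        omega
    · left
      have := h1 v hv hvx
      simp only [deg, hE, hI, cut_cons, mass_cons, crossing_mk] at this
      rw [ind_singleton_of_ne (Ne.symm hvx)] at *
      simp only [mass_cons]
      norm_num at *
      rw [abs_of_nonneg (ind_nonneg _ _)] at this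
      omega
  · intro D hD
    refine ⟨(x, u) ::ₘ D, by simp [hD, hE], fun v ↦ ?_⟩
    simp only [net_cons, rootNet, hI, mass_cons]
    ring
  · intro v hv N _ hN
    simpa using hN

/-- Lift two edges `xu` and `xw` to an edge `uw`. -/
theorem lift_pair {v₀ u w : V} (hk : 0 < k) (h : P.Admissible k v₀) (hs : P.StrictCuts k)
    (h1 : ∀ v ∈ P.verts, v ≠ x → 2 * k - 2 + circNorm k (P.target v) ≤ P.deg {v})
    (hx : circNorm k (P.target x) = 0)
    (hE : P.edges = s(x, u) ::ₘ s(x, w) ::ₘ E) (hxu : u ≠ x) (hxw : w ≠ x)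
    (huw : u = w → 2 * k + circNorm k (P.target u) ≤ P.deg {u}) :
    (P.modify (s(u, w) ::ₘ E) P.inn P.out x u 0 0).Admissible k x ∧
      ((P.modify (s(u, w) ::ₘ E) P.inn P.out x u 0 0).Solvable k → P.Solvable k) := by
  have huW : u ∈ P.verts := h.edges_mem s(x, u) (by simp [hE]) u (by simp)
  have hwW : w ∈ P.verts := h.edges_mem s(x, w) (by simp [hE]) w (by simp)
  refine ⟨h.modify hk hs ?_ ?_ ?_ ?_ ?_ ?_, Solvable.of_modify ?_ ?_⟩
  · intro e he
    rw [Multiset.mem_cons] at he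
    rcases he with rfl | he
    · simp [huW, hwW]
    · exact h.edges_mem e (by simp [hE, he])
  · intro A hA
    simp only [deg, hE, cut_cons, crossing_mk, ind_eq]
    split_ifs <;> norm_num <;> omega
  · simp [rootNet]
  · have := h.root
    simpa [rdeg] using this
  · intro A hA
    simp only [deg, hE, cut_cons, crossing_mk, ind_eq]
    split_ifs <;> norm_num <;> omega
  · intro v hv
    by_cases hvx : v = x
    · subst hvx
      right
      simpa using hx
    · left
      have := h1 v hv hvx
      simp only [deg, hE, cut_cons, crossing_mk] at this huw
      rw [cut_cons, crossing_mk]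
      rw [ind_singleton_of_ne (Ne.symm hvx)] at *
      by_cases hvu : u = v
      · subst hvu
        rw [ind_singleton_self] at *
        rw [ind_singleton_of_ne (Ne.symm hvx)] at *
        by_cases huw' : u = w
        · subst huw'
          rw [ind_singleton_self] at *
          norm_num at *
          omega
        · rw [ind_singleton_of_ne (Ne.symm huw')] at *
          norm_num at *
          omega
      · rw [ind_singleton_of_ne hvu] at *
        norm_num at *
        omega
  · intro D hD
    -- The arc on the lifted edge `uw` is rerouted through `x`, which leaves the net outdegree of
    -- `x` unchanged.
    obtain ⟨p, hp, hp'⟩ : ∃ p ∈ D, s(p.1, p.2) = s(u, w) := by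
      rw [← Multiset.mem_map]
      change _ ∈ underlying D
      simp [hD]
    obtain ⟨D, rfl⟩ := Multiset.exists_cons_of_mem hp
    rw [underlying_cons, hp', Multiset.cons_inj_right] at hD
    rw [Sym2.eq_iff] at hp'
    rcases hp' with ⟨hp1, hp2⟩ | ⟨hp1, hp2⟩
    · refine ⟨(u, x) ::ₘ (x, w) ::ₘ D, by simp [hD, hE, Sym2.eq_swap], fun v ↦ ?_⟩
      simp only [net_cons, rootNet, hp1, hp2]
      ring
    · refine ⟨(w, x) ::ₘ (x, u) ::ₘ D, ?_, fun v ↦ ?_⟩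
      · rw [hE, Multiset.cons_swap]
        simp [hD, Sym2.eq_swap]
      simp only [net_cons, rootNet, hp1, hp2]
      ring
  · intro v hv N _ hN
    simpa using hN

/-- Replace an edge `yw` by a root arc into `w`. -/
theorem reroute {v₀ w : V} (hk : 0 < k) (h : P.Admissible k v₀) (hs : P.StrictCuts k)
    (h1 : ∀ v ∈ P.verts, 2 * k - 2 + circNorm k (P.target v) ≤ P.deg {v})
    (hE : P.edges = s(y, w) ::ₘ E) (hyw : y ≠ w)
    (hy : circNorm k (P.target y - 1) = circNorm k (P.target y) - 1)
    (hroot : P.rdeg P.verts + 1 ≤ 2 * k - 2 + circNorm k (P.demand P.verts - 1)) :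
    (P.modify E (w ::ₘ P.inn) P.out y w (-1) 0).Admissible k v₀ ∧
      ((P.modify E (w ::ₘ P.inn) P.out y w (-1) 0).Solvable k → P.Solvable k) := by
  have hyW : y ∈ P.verts := h.edges_mem s(y, w) (by simp [hE]) y (by simp)
  have hwW : w ∈ P.verts := h.edges_mem s(y, w) (by simp [hE]) w (by simp)
  refine ⟨h.modify hk hs ?_ ?_ ?_ ?_ ?_ ?_, Solvable.of_modify ?_ ?_⟩
  · exact fun e he ↦ h.edges_mem e (by simp [hE, he])
  · intro A hA
    simp only [deg, hE, cut_cons, mass_cons, crossing_mk, ind_eq]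
    split_ifs <;> norm_num <;> omega
  · simp only [mass_cons, ind_of_mem hyW, ind_of_mem hwW, rootNet]
    ring
  · simp only [mass_cons, ind_of_mem hyW, ind_of_mem hwW, rdeg] at hroot ⊢
    norm_num
    rw [← sub_eq_add_neg]
    omega
  · intro A hA
    simp only [deg, hE, cut_cons, mass_cons, crossing_mk, ind_eq]
    split_ifs <;> norm_num <;> omega
  · intro v hv
    left
    have := h1 v hv
    simp only [deg, hE, cut_cons, crossing_mk] at this
    rw [mass_cons]
    by_cases hvx : v = y
    · subst hvx
      rw [ind_singleton_self, ind_singleton_of_ne hyw.symm] at *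
      norm_num at *
      rw [← sub_eq_add_neg, hy]
      omega
    · rw [ind_singleton_of_ne (Ne.symm hvx)] at *
      norm_num at *
      rw [abs_of_nonneg (ind_nonneg _ _)] at this
      omega
  · intro D hD
    refine ⟨(y, w) ::ₘ D, by simp [hD, hE], fun v ↦ ?_⟩
    simp only [net_cons, rootNet, mass_cons]
    ring
  · intro v hv
    have h2 := circNorm.nonneg (k := k) (x := P.target y - 1)
    exact abs_le_of_abs_add_le hk (fun _ ↦ by omega) (fun h ↦ absurd rfl h) (by simp) (by simp) hyw

/-- Delete a root arc leaving `x`. -/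
theorem delete_root_arc {v₀ : V} (hk : 0 < k) (h : P.Admissible k v₀) (hs : P.StrictCuts k)
    (h1 : ∀ v ∈ P.verts, 2 * k - 2 + circNorm k (P.target v) ≤ P.deg {v})
    (hO : P.out = x ::ₘ O) (hxW : x ∈ P.verts) (hxy : x ≠ y)
    (hx : circNorm k (P.target x - 1) = circNorm k (P.target x) - 1)
    (hroot : P.rdeg P.verts - 1 ≤ 2 * k - 2 + circNorm k (P.demand P.verts - 1)) :
    (P.modify P.edges P.inn O x y (-1) 0).Admissible k v₀ ∧
      ((P.modify P.edges P.inn O x y (-1) 0).Solvable k → P.Solvable k) := by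
  refine ⟨h.modify hk hs ?_ ?_ ?_ ?_ ?_ ?_, Solvable.of_modify ?_ ?_⟩
  · exact h.edges_mem
  · intro A hA
    simp only [deg, hO, mass_cons, ind_eq]
    split_ifs <;> norm_num
  · simp only [hO, mass_cons, ind_of_mem hxW, rootNet]
    ring
  · simp only [hO, mass_cons, ind_of_mem hxW, rdeg] at hroot ⊢
    norm_num
    rw [← sub_eq_add_neg]
    omega
  · intro A hA
    simp only [deg, hO, mass_cons, ind_eq]
    split_ifs <;> norm_num <;> omega
  · intro v hv
    left
    have := h1 v hv
    simp only [deg, hO, mass_cons] at this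
    by_cases hvx : v = x
    · subst hvx
      rw [ind_singleton_self] at *
      norm_num at *
      rw [← sub_eq_add_neg, hx]
      omega
    · rw [ind_singleton_of_ne (Ne.symm hvx)] at *
      norm_num at *
      omega
  · intro D hD
    refine ⟨D, hD, fun v ↦ ?_⟩
    simp only [rootNet, hO, mass_cons]
    ring
  · intro v hv
    have h2 := circNorm.nonneg (k := k) (x := P.target x - 1)
    exact abs_le_of_abs_add_le hk (fun _ ↦ by omega) (fun h ↦ absurd rfl h) (by simp) (by simp) hxy

/-- Delete an edge `xy` oriented from `y` to `x`, after adding root arcs leaving `x`. -/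
theorem add_root_arcs_delete_arc {v₀ : V} (hk : 1 < k) (h : P.Admissible k v₀)
    (hs : P.StrictCuts k) (h1 : ∀ v ∈ P.verts, 2 * k - 2 + circNorm k (P.target v) ≤ P.deg {v})
    (hE : P.edges = s(x, y) ::ₘ E) (hxy : x ≠ y) {t : ℕ} (ht : 1 ≤ t) (htk : t < k)
    (hx : (2 * k : ℤ) ∣ P.target x + t - k) (hxt : circNorm k (P.target x) = k - t)
    (hy : circNorm k (P.target y - 1) = circNorm k (P.target y) - 1)
    (hroot : P.rdeg P.verts + t ≤ 2 * k - 2 + circNorm k (P.demand P.verts + t)) :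
    (P.modify E P.inn (Multiset.replicate t x + P.out) x y (t + 1) (-1)).Admissible k v₀ ∧
      ((P.modify E P.inn (Multiset.replicate t x + P.out) x y (t + 1) (-1)).Solvable k →
        P.Solvable k) := by
  have hxW : x ∈ P.verts := h.edges_mem s(x, y) (by simp [hE]) x (by simp)
  have hyW : y ∈ P.verts := h.edges_mem s(x, y) (by simp [hE]) y (by simp)
  refine ⟨h.modify (by omega) hs ?_ ?_ ?_ ?_ ?_ ?_, Solvable.of_modify ?_ ?_⟩
  · exact fun e he ↦ h.edges_mem e (by simp [hE, he])
  · intro A hA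
    simp only [deg, hE, cut_cons, mass_add, mass_replicate, crossing_mk, ind_eq]
    split_ifs <;> norm_num <;> omega
  · simp only [mass_add, mass_replicate, ind_of_mem hxW, ind_of_mem hyW, rootNet]
    ring
  · simp only [mass_add, mass_replicate, ind_of_mem hxW, ind_of_mem hyW, rdeg] at hroot ⊢
    have e : ((t : ℤ) + 1) * 1 + -1 * 1 = t := by ring
    rw [e]
    omega
  · intro A hA
    simp only [deg, hE, cut_cons, mass_add, mass_replicate, crossing_mk, ind_eq]
    split_ifs <;> norm_num <;> try rw [abs_le]
    all_goals omega
  · intro v hv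
    left
    have := h1 v hv
    simp only [deg, hE, cut_cons, crossing_mk] at this
    rw [mass_add, mass_replicate]
    by_cases hvx : v = x
    · subst hvx
      rw [ind_singleton_self, ind_singleton_of_ne hxy.symm] at *
      -- The `t` root arcs bring the target to the antipode `k`, and the deleted arc entering this
      -- vertex moves it on to `k + 1`, of norm `k - 1`. The degree changes by `t - 1`, exactly as
      -- the norm does.
      have e : circNorm k (P.target v + ((t + 1) * 1 + -1 * 0)) = k - 1 := by
        obtain ⟨q, hq⟩ := hx
        rw [circNorm.congr (y := 1 - k) ⟨q + 1, by linear_combination hq⟩,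
          circNorm.eq_of_abs_le (by omega) (by rw [abs_le]; omega), abs_of_nonpos (by omega)]
        ring
      rw [e]
      norm_num at *
      omega
    by_cases hvy : v = y
    · subst hvy
      rw [ind_singleton_self, ind_singleton_of_ne hxy] at *
      norm_num at *
      rw [← sub_eq_add_neg, hy]
      omega
    · rw [ind_singleton_of_ne (Ne.symm hvx), ind_singleton_of_ne (Ne.symm hvy)] at *
      norm_num at *
      omega
  · intro D hD
    refine ⟨(y, x) ::ₘ D, by simp [hD, hE, Sym2.eq_swap], fun v ↦ ?_⟩
    simp only [net_cons, rootNet, mass_add, mass_replicate]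
    ring
  · intro v hv N hN hb
    by_cases hvx : v = x
    · subst hvx
      rw [ind_singleton_self, ind_singleton_of_ne hxy.symm] at hb
      obtain ⟨q, hq⟩ := hx
      obtain ⟨q', hq'⟩ := hN
      have e : N + t + 1 = 2 * k * (q + q') + (k + 1) := by linear_combination hq + hq'
      rw [abs_le] at hb ⊢
      -- Modulo `2k` the value is known, so the bound leaves only `k + 1` and `1 - k` for `N + t +
      -- 1`.
      have h1 : q + q' < 1 := by
        by_contra hc
        have : 2 * (k : ℤ) ≤ 2 * k * (q + q') := by nlinarith
        omega
      have h2 : -2 < q + q' := by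
        by_contra hc
        have : 2 * k * (q + q') ≤ -(4 * k : ℤ) := by nlinarith
        omega
      have h3 : q + q' = -1 ∨ q + q' = 0 := by omega
      rcases h3 with h3 | h3 <;> rw [h3] at e <;> omega
    by_cases hvy : v = y
    · subst hvy
      have h2 := circNorm.nonneg (k := k) (x := P.target v - 1)
      rw [ind_singleton_self, ind_singleton_of_ne hxy] at hb
      refine circNorm.abs_le_of_ne_zero (by omega) hN (by omega) ?_
      rw [abs_le] at hb ⊢
      omega
    · rw [ind_singleton_of_ne (Ne.symm hvx), ind_singleton_of_ne (Ne.symm hvy)] at hb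
      simpa using hb

end RootedGraph

end RootedGraphs

/-! ### Contracting a tight set and orienting its inside. -/

section RootedGraphs

set_option linter.unusedSectionVars false

variable {V : Type*} [DecidableEq V]

/-- Each arc over the image of an edge lifts to one of the two orientations of that edge. -/
theorem exists_underlying_map {U : Type*} {φ : V → U} {E : Multiset (Sym2 V)}
    {D : Multiset (U × U)} (h : underlying D = E.map (Sym2.map φ)) :
    ∃ D', underlying D' = E ∧ D'.map (Prod.map φ φ) = D := by
  obtain ⟨u, h1, h2⟩ := Multiset.exists_pullback (f := fun p : U × U ↦ s(p.1, p.2))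
    (g := Sym2.map φ) (p := Prod.map φ φ) (q := fun p : V × V ↦ s(p.1, p.2)) (by
    rintro ⟨a, b⟩ e he
    induction e with | _ x y =>
    rw [Sym2.map_mk, Sym2.eq_iff] at he
    rcases he with ⟨rfl, rfl⟩ | ⟨rfl, rfl⟩
    · exact ⟨(x, y), rfl, rfl⟩
    · exact ⟨(y, x), rfl, Sym2.eq_swap⟩) E D h
  exact ⟨u, h2, h1⟩

theorem cut_map {U : Type*} [DecidableEq U] {φ : V → U} {A : Finset V} {B : Finset U}
    (h : ∀ v, ind B (φ v) = ind A v) (E : Multiset (Sym2 V)) :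
    cut (E.map (Sym2.map φ)) B = cut E A := by
  induction E using Multiset.induction with
  | empty => simp
  | cons e E ih =>
    induction e with | _ x y => simp [ih, h]

theorem mass_map {U : Type*} [DecidableEq U] {φ : V → U} {A : Finset V} {B : Finset U}
    (h : ∀ v, ind B (φ v) = ind A v) (I : Multiset V) : mass (I.map φ) B = mass I A := by
  induction I using Multiset.induction with
  | empty => simp
  | cons v I ih => simp [ih, h]

theorem net_map {U : Type*} [DecidableEq U] {φ : V → U} {A : Finset V} {B : Finset U}
    (h : ∀ v, ind B (φ v) = ind A v) (D : Multiset (V × V)) :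
    net (D.map (Prod.map φ φ)) B = net D A := by
  induction D using Multiset.induction with
  | empty => simp
  | cons v I ih => simp [ih, h]

/-- The arcs of `D` with both ends in `A`. -/
def inside (D : Multiset (V × V)) (A : Finset V) : Multiset (V × V) :=
  D.filter fun p ↦ p.1 ∈ A ∧ p.2 ∈ A

/-- The arcs of `D` with an end outside `A`. -/
def notInside (D : Multiset (V × V)) (A : Finset V) : Multiset (V × V) :=
  D.filter fun p ↦ ¬(p.1 ∈ A ∧ p.2 ∈ A)

/-- The tails of the arcs of `D` leaving `A`. -/
def outTails (D : Multiset (V × V)) (A : Finset V) : Multiset V :=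
  (D.filter fun p ↦ p.1 ∈ A ∧ p.2 ∉ A).map Prod.fst

/-- The heads of the arcs of `D` entering `A`. -/
def inHeads (D : Multiset (V × V)) (A : Finset V) : Multiset V :=
  (D.filter fun p ↦ p.1 ∉ A ∧ p.2 ∈ A).map Prod.snd

theorem cut_eq_inside {A B : Finset V} (hB : B ⊆ A) (D : Multiset (V × V)) :
    cut (underlying D) B =
      cut (underlying (inside D A)) B + mass (inHeads D A) B + mass (outTails D A) B := by
  unfold inside inHeads outTails
  induction D using Multiset.induction with
  | empty => simp
  | cons p D ih =>
    obtain ⟨x, y⟩ := p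
    have hx := @hB x
    have hy := @hB y
    by_cases h1 : x ∈ A <;> by_cases h2 : y ∈ A <;>
      simp [h1, h2, ih, ind_eq] <;> split_ifs <;> simp_all <;> ring

theorem net_notInside {A B : Finset V} (hB : B ⊆ A) (D : Multiset (V × V)) :
    net (notInside D A) B = mass (outTails D A) B - mass (inHeads D A) B := by
  unfold notInside inHeads outTails
  induction D using Multiset.induction with
  | empty => simp
  | cons p D ih =>
    obtain ⟨x, y⟩ := p
    have hx := @hB x
    have hy := @hB y
    by_cases h1 : x ∈ A <;> by_cases h2 : y ∈ A <;>
      simp [h1, h2, ind_eq] at ih ⊢ <;> rw [ih] <;> split_ifs <;> simp_all <;> ring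

theorem inside_add_notInside (A : Finset V) (D : Multiset (V × V)) :
    inside D A + notInside D A = D := Multiset.filter_add_not _ _

theorem net_eq_zero {D : Multiset (V × V)} {A : Finset V} (h : ∀ p ∈ D, p.1 ∈ A ↔ p.2 ∈ A) :
    net D A = 0 := by
  apply Multiset.sum_eq_zero
  intro c hc
  obtain ⟨p, hp, rfl⟩ := Multiset.mem_map.1 hc
  simp [ind_eq, h p hp]

theorem mem_of_mem_inside {D : Multiset (V × V)} {A : Finset V} {p : V × V}
    (h : s(p.1, p.2) ∈ underlying (inside D A)) : p.1 ∈ A ∧ p.2 ∈ A := by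
  obtain ⟨q, hq, he⟩ := Multiset.mem_map.1 h
  have := (Multiset.mem_filter.1 hq).2
  rw [Sym2.eq_iff] at he
  grind

namespace RootedGraph

variable {P : RootedGraph V} {k : ℕ}

/-- The map that collapses `A` to `a`. -/
def collapse (A : Finset V) (a v : V) : V := if v ∈ A then a else v

/-- The rooted graph obtained by contracting `A` to its element `a`. -/
def contract (P : RootedGraph V) (A : Finset V) (a : V) : RootedGraph V :=
  ⟨insert a (P.verts \ A), P.edges.map (Sym2.map (collapse A a)), P.inn.map (collapse A a),
    P.out.map (collapse A a), fun v ↦ ∑ u ∈ P.verts with collapse A a u = v, P.target u⟩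

/-- The preimage of a set of vertices of the contraction. -/
def expand (P : RootedGraph V) (A : Finset V) (a : V) (B : Finset V) : Finset V :=
  P.verts.filter fun v ↦ collapse A a v ∈ B

variable {A B : Finset V} {a : V}

theorem mem_expand {v : V} : v ∈ P.expand A a B ↔ v ∈ P.verts ∧ collapse A a v ∈ B :=
  Finset.mem_filter

theorem ind_expand (hA : A ⊆ P.verts) (ha : a ∈ A) (hB : B ⊆ (P.contract A a).verts) (v : V) :
    ind B (collapse A a v) = ind (P.expand A a B) v := by
  have hB' : ∀ u, u ∈ B → u = a ∨ (u ∈ P.verts ∧ u ∉ A) := fun u hu ↦ by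
    simpa [contract] using hB hu
  simp only [ind_eq, expand, Finset.mem_filter]
  congr 1
  refine propext ⟨fun h ↦ ⟨?_, h⟩, fun h ↦ h.2⟩
  by_cases hv : v ∈ A
  · exact hA hv
  · rw [collapse, if_neg hv] at h
    rcases hB' v h with rfl | h
    · exact absurd ha hv
    · exact h.1

theorem contract_deg (hA : A ⊆ P.verts) (ha : a ∈ A) (hB : B ⊆ (P.contract A a).verts) :
    (P.contract A a).deg B = P.deg (P.expand A a B) := by
  have := ind_expand hA ha hB
  simp only [deg, contract, cut_map this, mass_map this]

theorem contract_rdeg (hA : A ⊆ P.verts) (ha : a ∈ A) (hB : B ⊆ (P.contract A a).verts) :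
    (P.contract A a).rdeg B = P.rdeg (P.expand A a B) := by
  have := ind_expand hA ha hB
  simp only [rdeg, contract, mass_map this]

theorem contract_rootNet (hA : A ⊆ P.verts) (ha : a ∈ A) (hB : B ⊆ (P.contract A a).verts) :
    (P.contract A a).rootNet B = P.rootNet (P.expand A a B) := by
  have := ind_expand hA ha hB
  simp only [rootNet, contract, mass_map this]

theorem contract_demand : (P.contract A a).demand B = P.demand (P.expand A a B) := by
  simp only [demand, contract, expand]
  rw [← Finset.sum_fiberwise_of_maps_to (s := P.verts.filter fun v ↦ collapse A a v ∈ B)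
    (t := B) (g := collapse A a) (fun v hv ↦ (Finset.mem_filter.1 hv).2)]
  refine Finset.sum_congr rfl fun b hb ↦ Finset.sum_congr ?_ fun _ _ ↦ rfl
  ext v
  simp only [Finset.mem_filter]
  constructor
  · rintro ⟨h1, rfl⟩
    exact ⟨⟨h1, hb⟩, rfl⟩
  · rintro ⟨⟨h1, _⟩, h2⟩
    exact ⟨h1, h2⟩

theorem expand_verts : P.expand A a (P.contract A a).verts = P.verts := by
  refine Finset.filter_true_of_mem fun v hv ↦ ?_
  by_cases h : v ∈ A <;> simp [collapse, contract, h, hv]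

/-- Sets of vertices of the contraction correspond to sets of `P` that contain or avoid `A`, with
the same degree, root arcs and demand. -/
theorem contract_admissible {v₀ : V} (h : P.Admissible k v₀) (hA : A ⊆ P.verts) (ha : a ∈ A)
    (hc : 2 ≤ A.card) : (P.contract A a).Admissible k v₀ where
  edges_mem e he v hv := by
    obtain ⟨e', he', rfl⟩ := Multiset.mem_map.1 he
    obtain ⟨u, hu, rfl⟩ := Sym2.mem_map.1 hv
    have := h.edges_mem e' he' u hu
    by_cases h : u ∈ A <;> simp [collapse, contract, h, this]
  parity B hB := by
    rw [contract_demand, contract_deg hA ha hB]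
    exact h.parity _ (Finset.filter_subset _ _)
  sum := by
    rw [contract_demand, contract_rootNet hA ha subset_rfl, expand_verts]
    exact h.sum
  root := by
    rw [contract_demand, contract_rdeg hA ha subset_rfl, expand_verts]
    exact h.root
  cut B hB hne hB' := by
    have hmem : ∀ b ∈ B, b ∈ P.expand A a B := fun b hb ↦ by
      have := hB hb
      simp only [contract, Finset.mem_insert, Finset.mem_sdiff] at this
      rcases this with rfl | this
      · simp [mem_expand, collapse, ha, hA ha, hb]
      · simp [mem_expand, collapse, this, hb]
    have hsub : a ∈ B → A ⊆ P.expand A a B := fun haB v hv ↦ by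
      simp [mem_expand, collapse, hv, hA hv, haB]
    rw [contract_demand, contract_deg hA ha hB]
    refine (h.cut (P.expand A a B) (Finset.filter_subset _ _) ?_ ?_).imp id ?_
    · obtain ⟨b, hb⟩ := hne
      exact ⟨b, hmem b hb⟩
    · intro he
      apply hB'
      refine hB.antisymm fun v hv ↦ ?_
      simp only [contract, Finset.mem_insert, Finset.mem_sdiff] at hv
      rcases hv with rfl | hv
      · have : v ∈ P.expand A v B := he ▸ hA ha
        simpa [expand, collapse, ha] using (Finset.mem_filter.1 this).2
      · have : v ∈ P.expand A a B := he ▸ hv.1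
        simpa [expand, collapse, hv.2] using (Finset.mem_filter.1 this).2
    · rintro ⟨he, h0⟩
      -- The exempt set is a single vertex, so its preimage cannot contain `A`, which has at least
      -- two elements.
      have haB : a ∉ B := fun haB ↦ by
        have := Finset.card_le_card (hsub haB)
        rw [he, Finset.card_singleton] at this
        omega
      have hBv : B = {v₀} := by
        obtain ⟨b, hb⟩ := hne
        refine Finset.eq_singleton_iff_nonempty_unique_mem.2 ⟨⟨b, hb⟩, fun c hc ↦ ?_⟩
        simpa [he] using hmem c hc
      refine ⟨hBv, ?_⟩
      have h1 := contract_demand (P := P) (A := A) (a := a) (B := B)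
      rw [he, hBv, demand_singleton, demand_singleton] at h1
      rw [h1, h0]

/-- The rooted graph induced on `A`, all arcs of `D` between `A` and its complement becoming root
arcs. -/
def restrict (P : RootedGraph V) (D : Multiset (V × V)) (A : Finset V) : RootedGraph V :=
  ⟨A, underlying (inside D A), P.inn + inHeads D A, P.out + outTails D A, P.target⟩

theorem restrict_deg {D : Multiset (V × V)} (hD : underlying D = P.edges) (hB : B ⊆ A) :
    (P.restrict D A).deg B = P.deg B := by
  simp only [deg, restrict, mass_add, ← hD, cut_eq_inside hB D]
  ring

/-- No edge of the restriction leaves `A`, so every edge of the old cut has become a root arc. -/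
theorem restrict_rdeg {D : Multiset (V × V)} (hD : underlying D = P.edges) :
    (P.restrict D A).rdeg A = P.deg A := by
  have h0 : _root_.cut (underlying (inside D A)) A = 0 :=
    cut_eq_zero fun x y he _ ↦ (mem_of_mem_inside (p := (x, y)) he).2
  have := restrict_deg hD (subset_refl A)
  rw [deg_eq] at this
  rw [← this]
  simp [restrict, h0]

/-- Contracting a vertex set `A` with a tight cut, and then orienting inside `A`. -/
theorem solvable_of_tight {v₀ : V} (h : P.Admissible k v₀)
    (hA : A ⊆ P.verts) (hc : 2 ≤ A.card) (hne : A ≠ P.verts)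
    (ht : P.deg A ≤ 2 * k - 2 + circNorm k (P.demand A))
    (ih : ∀ Q : RootedGraph V, 2 ≤ Q.verts.card → Q.verts.card < P.verts.card →
      (∃ v, Q.Admissible k v) → Q.Solvable k) : P.Solvable k := by
  obtain ⟨a, ha⟩ : A.Nonempty := by
    rw [← Finset.card_pos]
    omega
  have hlt : A.card < P.verts.card := Finset.card_lt_card (hA.ssubset_of_ne hne)
  have hcard : (P.contract A a).verts.card = P.verts.card - A.card + 1 := by
    rw [contract, Finset.card_insert_of_notMem (by simp [ha]), Finset.card_sdiff_of_subset hA]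
  obtain ⟨D₁, h1, h2⟩ := ih (P.contract A a) (by omega) (by omega)
    ⟨v₀, contract_admissible h hA ha hc⟩
  obtain ⟨D, hD, rfl⟩ := exists_underlying_map h1
  have hexp : P.expand A a {a} = A := by
    ext v
    simp only [expand, Finset.mem_filter, Finset.mem_singleton, collapse]
    constructor
    · rintro ⟨_, h⟩
      by_contra hv
      rw [if_neg hv] at h
      exact hv (h ▸ ha)
    · exact fun hv ↦ ⟨hA hv, if_pos hv⟩
  have hexp' : ∀ v ∈ P.verts, v ∉ A → P.expand A a {v} = {v} := fun v hv hvA ↦ by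
    ext u
    simp only [expand, Finset.mem_filter, Finset.mem_singleton, collapse]
    constructor
    · rintro ⟨_, h⟩
      split_ifs at h with hu
      · exact absurd (h ▸ ha) hvA
      · exact h
    · rintro rfl
      exact ⟨hv, if_neg hvA⟩
  have hnet : ∀ B ⊆ (P.contract A a).verts,
      net (D.map (Prod.map (collapse A a) (collapse A a))) B = net D (P.expand A a B) :=
    fun B hB ↦ net_map (ind_expand hA ha hB) D
  have hnot : ∀ B ⊆ A, (P.restrict D A).rootNet B = P.rootNet B + net (notInside D A) B :=
    fun B hB ↦ by
      rw [net_notInside hB]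
      simp only [rootNet, restrict, mass_add]
      ring
  have h0 : net (inside D A) A = 0 := net_eq_zero fun p hp ↦ by
    have := (Multiset.mem_filter.1 hp).2
    simp [this.1, this.2]
  have hadm : (P.restrict D A).Admissible k v₀ := by
    refine ⟨?_, ?_, ?_, ?_, ?_⟩
    · intro e he v hv
      induction e with | _ x y =>
      have := mem_of_mem_inside (p := (x, y)) he
      rcases Sym2.mem_iff.1 hv with rfl | rfl
      · exact this.1
      · exact this.2
    · intro B hB
      change B ⊆ A at hB
      rw [restrict_deg hD hB]
      exact h.parity B (hB.trans hA)
    -- The orientation of the contraction already gives `A` as a whole its prescribed net outdegree.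
    -- This is the sum condition for the restriction.
    · change _ ∣ P.demand A - (P.restrict D A).rootNet A
      have haW : {a} ⊆ (P.contract A a).verts := by simp [contract]
      have := (h2 a (by simp [contract])).1
      rw [← demand_singleton, contract_demand, contract_rootNet hA ha haW, hnet _ haW, hexp] at this
      have h5 : net D A = net (notInside D A) A := by
        conv_lhs => rw [← inside_add_notInside A D, net_add, h0, zero_add]
      obtain ⟨c, hc⟩ := this
      rw [hnot A subset_rfl, ← h5]
      exact ⟨-c, by linear_combination -hc⟩
    -- Tightness of the cut around `A` is exactly the root condition inside `A`.
    · change (P.restrict D A).rdeg A ≤ 2 * k - 2 + circNorm k (P.demand A)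
      rw [restrict_rdeg hD]
      exact ht
    · intro B hB hBne hBA
      change B ⊆ A at hB
      rw [restrict_deg hD hB]
      refine h.cut B (hB.trans hA) hBne ?_
      rintro rfl
      exact hne (hA.antisymm hB)
  obtain ⟨D₂, h3, h4⟩ := ih (P.restrict D A) hc hlt ⟨v₀, hadm⟩
  -- Arcs inside `A` come from the second orientation, all others from the first. Vertices outside
  -- `A` see no change, as arcs inside `A` do not meet them.
  refine ⟨D₂ + notInside D A, ?_, fun v hv ↦ ?_⟩
  · rw [underlying_add, h3, ← hD]
    conv_rhs => rw [← inside_add_notInside A D, underlying_add]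
    rfl
  · rw [net_add]
    by_cases hvA : v ∈ A
    · have := h4 v hvA
      rw [hnot {v} (by simpa using hvA)] at this
      rw [add_assoc, add_comm (net (notInside D A) {v})]
      exact this
    · have hvW : {v} ⊆ (P.contract A a).verts := by simp [contract, hv, hvA]
      have := h2 v (by simp [contract, hv, hvA])
      rw [← demand_singleton, contract_demand, contract_rootNet hA ha hvW, hnet _ hvW,
        hexp' v hv hvA, demand_singleton] at this
      have e1 : net D₂ {v} = 0 := net_eq_zero fun p hp ↦ by
        have := mem_of_mem_inside (D := D) (A := A) (p := p) (by
          change _ ∈ (P.restrict D A).edges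
          rw [← h3]
          exact Multiset.mem_map_of_mem _ hp)
        have h1 : p.1 ≠ v := fun h ↦ hvA (h ▸ this.1)
        have h2 : p.2 ≠ v := fun h ↦ hvA (h ▸ this.2)
        simp [h1, h2]
      have e2 : net (inside D A) {v} = 0 := net_eq_zero fun p hp ↦ by
        have := (Multiset.mem_filter.1 hp).2
        have h1 : p.1 ≠ v := fun h ↦ hvA (h ▸ this.1)
        have h2 : p.2 ≠ v := fun h ↦ hvA (h ▸ this.2)
        simp [h1, h2]
      have e3 : net D {v} = net (notInside D A) {v} := by
        conv_lhs => rw [← inside_add_notInside A D, net_add, e2, zero_add]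
      rw [e1, zero_add, ← e3]
      exact this

end RootedGraph

end RootedGraphs

/-! ### Base case: two vertices besides the root. -/

section RootedGraphs

set_option linter.unusedSectionVars false

variable {V : Type*} [DecidableEq V]

theorem exists_mem_of_mass_pos {I : Multiset V} {A : Finset V} (h : 0 < mass I A) :
    ∃ v ∈ I, v ∈ A := by
  by_contra! hc
  have : mass I A = 0 := Multiset.sum_eq_zero fun c hc' ↦ by
    obtain ⟨v, hv, rfl⟩ := Multiset.mem_map.1 hc'
    exact ind_of_notMem (hc v hv)
  omega

namespace RootedGraph

variable {P : RootedGraph V} {k : ℕ} {v₀ : V}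

theorem abs_rootNet_le (A : Finset V) : |P.rootNet A| ≤ P.rdeg A := by
  have h1 := mass_nonneg P.inn A
  have h2 := mass_nonneg P.out A
  rw [rootNet, rdeg, abs_le]
  omega

/-- The root net is congruent to the total demand and bounded by the root degree, so
`abs_le_of_abs_le_add` applies. -/
theorem abs_rootNet_verts_le (hk : 0 < k) (h : P.Admissible k v₀) :
    |P.rootNet P.verts| ≤ 2 * k - 1 := by
  refine circNorm.abs_le_of_abs_le_add (x := P.demand P.verts) hk ?_
    ((abs_rootNet_le _).trans h.root)
  obtain ⟨c, hc⟩ := h.sum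
  exact ⟨-c, by linear_combination -hc⟩

theorem rootNet_union {A B : Finset V} (h : Disjoint A B) :
    P.rootNet (A ∪ B) = P.rootNet A + P.rootNet B := by
  simp only [rootNet, mass_union h]; ring

theorem net_verts {D : Multiset (V × V)} (h : P.Admissible k v₀) (hD : underlying D = P.edges) :
    net D P.verts = 0 := by
  refine net_eq_zero fun p hp ↦ ?_
  have := h.edges_mem s(p.1, p.2) (hD ▸ Multiset.mem_map_of_mem _ hp)
  simp [this p.1 (by simp), this p.2 (by simp)]

theorem cut_verts (h : P.Admissible k v₀) : cut P.edges P.verts = 0 :=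
  cut_eq_zero fun x y he _ ↦ h.edges_mem _ he y (by simp)

/-- One number decides everything: with net outdegree `N` at `x`, the value at `y` is the total root
net minus `N`. Parity and size are the only obstructions to realizing `N` on the parallel edges. -/
theorem solvable_pair_of_net {x y : V} (hxy : x ≠ y) (hW : P.verts = {x, y})
    (h : P.Admissible k v₀) (N : ℤ) (h1 : |N - P.rootNet {x}| ≤ cut P.edges {x})
    (h2 : (2 * k : ℤ) ∣ N - P.target x) (h3 : |N| ≤ 2 * k - 1)
    (h4 : |P.rootNet P.verts - N| ≤ 2 * k - 1) : P.Solvable k := by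
  have hdisj : Disjoint {x} ({y} : Finset V) := by simpa using hxy
  have hW' : P.verts = {x} ∪ {y} := hW
  obtain ⟨q, hq⟩ := h2
  have hpar : (2 : ℤ) ∣ N - P.rootNet {x} - cut P.edges {x} := by
    have h5 := h.parity {x} (by simp [hW])
    rw [demand_singleton, deg_eq] at h5
    have h6 : (2 : ℤ) ∣ N - P.target x := ⟨k * q, by rw [hq]; ring⟩
    simp only [rdeg, rootNet] at *
    omega
  obtain ⟨D, hD, hN⟩ := exists_net_eq P.edges {x} _ h1 hpar
  have hnet : net D {y} = -net D {x} := by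
    have := net_verts h hD
    rw [hW', net_union hdisj] at this
    omega
  obtain ⟨c, hc⟩ := h.sum
  have hd : P.demand P.verts = P.target x + P.target y := by
    rw [hW', demand_union hdisj, demand_singleton, demand_singleton]
  have hr : P.rootNet P.verts = P.rootNet {x} + P.rootNet {y} := by
    rw [hW', rootNet_union hdisj]
  refine ⟨D, hD, fun v hv ↦ ?_⟩
  have : v = x ∨ v = y := by simpa [hW] using hv
  rcases this with rfl | rfl
  · rw [hN, sub_add_cancel]
    exact ⟨⟨q, hq⟩, h3⟩
  · have e : net D {v} + P.rootNet {v} = P.rootNet P.verts - N := by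
      rw [hnet, hN, hr]
      ring
    rw [e]
    exact ⟨⟨-c - q, by linear_combination hd - hc - hq⟩, h4⟩

theorem StrictCuts.reverse (hk : 0 < k) (hs : P.StrictCuts k) : P.reverse.StrictCuts k := by
  intro A hA h2 hne
  rw [reverse_demand, reverse_deg, circNorm.neg hk]
  exact hs A hA h2 hne

theorem solvable_of_lift_root {x : V} (hk : 0 < k) (h : P.Admissible k v₀) (hs : P.StrictCuts k)
    (h1 : ∀ v ∈ P.verts, v ≠ x → 2 * k - 2 + circNorm k (P.target v) ≤ P.deg {v})
    (hx : circNorm k (P.target x) = 0 ∨ 2 * k + circNorm k (P.target x) ≤ P.deg {x})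
    (hcut : 0 < cut P.edges {x}) (hroot : 0 < P.rdeg {x})
    (ihE : ∀ Q : RootedGraph V, Q.verts = P.verts → Q.edges.card < P.edges.card →
      (∃ v, Q.Admissible k v) → Q.Solvable k) : P.Solvable k := by
  obtain ⟨x', u, he, hx', hu⟩ := exists_crossing hcut
  obtain rfl : x' = x := by simpa using hx'
  obtain ⟨E, hE⟩ := Multiset.exists_cons_of_mem he
  have hxu : x' ≠ u := by simpa [eq_comm] using hu
  have hcard : E.card < P.edges.card := by simp [hE]
  by_cases hI : 0 < mass P.inn {x'}
  · obtain ⟨v, hv, hv'⟩ := exists_mem_of_mass_pos hI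
    obtain rfl : v = x' := by simpa using hv'
    obtain ⟨I, hI⟩ := Multiset.exists_cons_of_mem hv
    obtain ⟨hadm, hsol⟩ := lift_root hk h hs h1 hx hE hxu hI
    exact hsol (ihE _ rfl hcard ⟨_, hadm⟩)
  · obtain ⟨v, hv, hv'⟩ := exists_mem_of_mass_pos (I := P.out) (A := {x'}) (by
      simp only [rdeg] at hroot
      omega)
    obtain rfl : v = x' := by simpa using hv'
    obtain ⟨I, hI⟩ := Multiset.exists_cons_of_mem hv
    have hn : ∀ v, circNorm k (P.reverse.target v) = circNorm k (P.target v) :=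
      fun v ↦ circNorm.neg hk _
    obtain ⟨hadm, hsol⟩ := lift_root hk (h.reverse hk) (hs.reverse hk)
      (fun w hw hwv ↦ by rw [hn, reverse_deg]; exact h1 w hw hwv)
      (by rw [hn, reverse_deg]; exact hx) hE hxu hI
    exact Solvable.of_reverse (hsol (ihE _ rfl hcard ⟨_, hadm⟩))

/-- The vertex `x` is the one at which root arcs are lifted when its degree is not tight. The
hypothesis `hy'` says that `x` was well chosen: if lifting at `x` is impossible because `x` is
tight, then `y` is tight too, and both net outdegrees are bounded by their degrees. -/
theorem solvable_of_pair {x y : V} (hk : 2 ≤ k) (hxy : x ≠ y) (hW : P.verts = {x, y})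
    (h : P.Admissible k v₀)
    (hx : 2 * k - 2 + circNorm k (P.target x) ≤ P.deg {x} ∨ circNorm k (P.target x) = 0)
    (hy : 2 * k - 2 + circNorm k (P.target y) ≤ P.deg {y})
    (hy' : circNorm k (P.target x) ≠ 0 → P.deg {x} ≤ 2 * k - 2 + circNorm k (P.target x) →
      P.deg {y} ≤ 2 * k - 2 + circNorm k (P.target y))
    (ihE : ∀ Q : RootedGraph V, Q.verts = P.verts → Q.edges.card < P.edges.card →
      (∃ v, Q.Admissible k v) → Q.Solvable k) : P.Solvable k := by
  have hk0 : 0 < k := by omega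
  have hdisj : Disjoint {x} ({y} : Finset V) := by simpa using hxy
  have hW' : P.verts = {x} ∪ {y} := hW
  have hd : P.demand P.verts = P.target x + P.target y := by
    rw [hW', demand_union hdisj, demand_singleton, demand_singleton]
  have hr : P.rdeg P.verts = P.rdeg {x} + P.rdeg {y} := by rw [hW', rdeg_union hdisj]
  have hr' : P.rootNet P.verts = P.rootNet {x} + P.rootNet {y} := by rw [hW', rootNet_union hdisj]
  have hm : cut P.edges {y} = cut P.edges {x} := cut_compl h.edges_mem fun v hv ↦ by
    have : v = x ∨ v = y := by simpa [hW] using hv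
    rcases this with rfl | rfl <;> simp [hxy, hxy.symm]
  have hroot := h.root
  have hC := abs_rootNet_verts_le hk0 h
  have hadd := circNorm.add_le hk0 (P.target x) (P.target y)
  have hax := abs_rootNet_le (P := P) {x}
  have hay := abs_rootNet_le (P := P) {y}
  have hnx := circNorm.nonneg (k := k) (x := P.target x)
  rw [hr, hd] at hroot
  rw [deg_eq, deg_eq, hm] at hy'
  rw [deg_eq, hm] at hy
  rw [deg_eq] at hx
  by_cases h0 : circNorm k (P.target x) = 0
  -- Net outdegree zero is possible: the condition at `y` and the root condition together give at
  -- least as many edges `xy` as root arcs at `x`.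
  · refine solvable_pair_of_net hxy hW h 0 ?_ ?_ (by simp; omega) (by simpa using hC)
    · rw [zero_sub, abs_neg]
      omega
    · rw [circNorm.eq_zero_iff hk0] at h0
      simpa using h0
  have hx := hx.resolve_right h0
  by_cases hrx : P.rdeg {x} = 0
  · have hrx' : P.rootNet {x} = 0 := by
      rw [hrx] at hax
      simpa using hax
    have hcut : 2 * (k : ℤ) - 1 ≤ cut P.edges {x} := by omega
    have hr0 : P.target x % (2 * k) ≠ 0 := fun hc ↦
      h0 ((circNorm.eq_zero_iff hk0).2 (Int.dvd_of_emod_eq_zero hc))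
    have hr1 := Int.emod_nonneg (P.target x) (b := 2 * k) (by omega)
    have hr2 := Int.emod_lt_of_pos (P.target x) (b := 2 * k) (by omega)
    have hr3 := Int.mul_ediv_add_emod (P.target x) (2 * k)
    rw [abs_le] at hC
    -- With at least `2k - 1` edges `xy` both representatives below `2k` in absolute value can be
    -- realized. The one with the sign of the root net keeps the difference, which is the value at
    -- `y`, small.
    by_cases hCs : 0 ≤ P.rootNet P.verts
    · refine solvable_pair_of_net hxy hW h (P.target x % (2 * k)) ?_ ?_ ?_ ?_
      · rw [hrx', sub_zero, abs_le]; omega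
      · exact ⟨-(P.target x / (2 * k)), by linear_combination hr3⟩
      · rw [abs_le]; omega
      · rw [abs_le]; omega
    · refine solvable_pair_of_net hxy hW h (P.target x % (2 * k) - 2 * k) ?_ ?_ ?_ ?_
      · rw [hrx', sub_zero, abs_le]; omega
      · exact ⟨-(P.target x / (2 * k)) - 1, by linear_combination hr3⟩
      · rw [abs_le]; omega
      · rw [abs_le]; omega
  have hrx : 0 < P.rdeg {x} := lt_of_le_of_ne (rdeg_nonneg _) (Ne.symm hrx)
  by_cases htx : 2 * k + circNorm k (P.target x) ≤ P.deg {x}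
  · refine solvable_of_lift_root hk0 h ?_ ?_ (Or.inr htx) ?_ hrx ihE
    · intro A hA hc hne
      refine absurd (Finset.eq_of_subset_of_card_le hA ?_) hne
      rw [hW, Finset.card_pair hxy]
      exact hc
    · intro v hv hvx
      obtain rfl : v = y := by simpa [hW, hvx] using hv
      rw [deg_eq, hm]
      exact hy
    · rw [deg_eq] at htx
      omega
  have hpx := h.parity {x} (by simp [hW])
  have hpx' := circNorm.parity hk0 (P.target x)
  rw [demand_singleton] at hpx
  rw [deg_eq] at hpx htx
  have hty := hy' h0 (by omega)
  -- The smallest attainable value at `x` is `rootNet - cut`, and `r` is the shift from it to the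
  -- next number of the right residue. Parity makes `r` even, so `r ≤ 2k - 2`. Tightness at both
  -- vertices and the root condition give `2 * cut ≥ 2k - 2`, so the shift stays within reach.
  have hr1 := Int.emod_nonneg (P.target x - (P.rootNet {x} - cut P.edges {x})) (b := 2 * k)
    (by omega)
  have hr2 := Int.emod_lt_of_pos (P.target x - (P.rootNet {x} - cut P.edges {x})) (b := 2 * k)
    (by omega)
  have hr3 := Int.mul_ediv_add_emod (P.target x - (P.rootNet {x} - cut P.edges {x})) (2 * k)
  set r := (P.target x - (P.rootNet {x} - cut P.edges {x})) % (2 * k) with hr_def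
  set q := (P.target x - (P.rootNet {x} - cut P.edges {x})) / (2 * k) with hq_def
  have hpr : (2 : ℤ) ∣ r := by
    have e : r = P.target x - (P.rootNet {x} - cut P.edges {x}) - 2 * (k * q) := by
      linear_combination hr3
    rw [e]
    simp only [rootNet, rdeg] at *
    omega
  have hNx : |r - cut P.edges {x}| ≤ cut P.edges {x} := by
    rw [abs_le]
    omega
  have hd1 : (2 * k : ℤ) ∣ r + P.rootNet {x} - cut P.edges {x} - P.target x :=
    ⟨-q, by linear_combination hr3⟩
  have hab : ∀ a b c : ℤ, |a| ≤ b → |c| ≤ cut P.edges {x} → |a + c| ≤ b + cut P.edges {x} :=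
    fun a b c h1 h2 ↦ (abs_add_le _ _).trans (by omega)
  refine solvable_pair_of_net hxy hW h (r + P.rootNet {x} - cut P.edges {x}) ?_ hd1 ?_ ?_
  · convert hNx using 2
    ring
  · refine circNorm.abs_le_of_abs_le_add hk0 hd1 ?_
    have := hab _ _ _ hax hNx
    rw [show r + P.rootNet {x} - cut P.edges {x} = P.rootNet {x} + (r - cut P.edges {x}) by ring]
    omega
  · refine circNorm.abs_le_of_abs_le_add (x := P.target y) hk0 ?_ ?_
    · obtain ⟨c, hc⟩ := h.sum
      obtain ⟨c', hc'⟩ := hd1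
      exact ⟨-c - c', by linear_combination hd - hc - hc'⟩
    · have := hab _ _ (-(r - cut P.edges {x})) hay (by rwa [abs_neg])
      rw [show P.rootNet P.verts - (r + P.rootNet {x} - cut P.edges {x}) =
        P.rootNet {y} + -(r - cut P.edges {x}) by rw [hr']; ring]
      omega

theorem solvable_of_card_two (hk : 2 ≤ k) (hW : P.verts.card = 2) (h : P.Admissible k v₀)
    (ihE : ∀ Q : RootedGraph V, Q.verts = P.verts → Q.edges.card < P.edges.card →
      (∃ v, Q.Admissible k v) → Q.Solvable k) : P.Solvable k := by
  obtain ⟨x, y, hxy, hW⟩ := Finset.card_eq_two.1 hW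
  have hx := h.cut {x} (by simp [hW]) (by simp) (fun h ↦ by
    have := Finset.card_pair hxy
    rw [← hW, ← h, Finset.card_singleton] at this
    omega)
  have hy := h.cut {y} (by simp [hW]) (by simp) (fun h ↦ by
    have := Finset.card_pair hxy
    rw [← hW, ← h, Finset.card_singleton] at this
    omega)
  rw [demand_singleton, Finset.singleton_inj] at hx hy
  have hWs : P.verts = {y, x} := by rw [hW, Finset.pair_comm]
  rcases hy with hy | ⟨rfl, hy⟩
  · have hx' : 2 * k - 2 + circNorm k (P.target x) ≤ P.deg {x} ∨ circNorm k (P.target x) = 0 := by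
      rcases hx with hx | ⟨rfl, hx⟩
      · exact Or.inl hx
      · exact Or.inr hx
    by_cases hyt : P.deg {y} ≤ 2 * k - 2 + circNorm k (P.target y)
    · exact solvable_of_pair hk hxy hW h hx' hy (fun _ _ ↦ hyt) ihE
    rcases hx with hx | ⟨rfl, hx⟩
    · exact solvable_of_pair hk hxy.symm hWs h (Or.inl hy) hx (fun _ hc ↦ absurd hc hyt) ihE
    · exact solvable_of_pair hk hxy hW h hx' hy (fun h0 ↦ absurd hx h0) ihE
  · rcases hx with hx | ⟨rfl, hx⟩
    · exact solvable_of_pair hk hxy.symm hWs h (Or.inr hy) hx (fun h0 ↦ absurd hy h0) ihE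
    · exact absurd rfl hxy

end RootedGraph

end RootedGraphs

/-! ### The induction step and the orientation theorem. -/

section RootedGraphs

set_option linter.unusedSectionVars false

variable {V : Type*} [DecidableEq V]

theorem cut_eq_cut_pair_add_cut {E : Multiset (Sym2 V)} {u v : V} (huv : u ≠ v)
    (h : ∀ w, s(v, w) ∈ E → w = v ∨ w = u) : cut E {u} = cut E {u, v} + cut E {v} := by
  unfold cut
  rw [← Multiset.sum_map_add]
  congr 1
  refine Multiset.map_congr rfl fun e he ↦ ?_
  induction e with | _ x y =>
  have h1 : x = v → y = v ∨ y = u := by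
    rintro rfl
    exact h y he
  have h2 : y = v → x = v ∨ x = u := by
    rintro rfl
    exact h x (Sym2.eq_swap ▸ he)
  simp only [crossing_mk, ind_eq, Finset.mem_singleton, Finset.mem_insert]
  by_cases hx : x = v
  · subst hx
    rcases h1 rfl with rfl | rfl <;> simp [huv, huv.symm]
  · by_cases hy : y = v
    · subst hy
      rcases h2 rfl with rfl | rfl <;> simp [huv, huv.symm]
    · simp [hx, hy]

namespace RootedGraph

variable {P : RootedGraph V} {k : ℕ} {v₀ : V}

theorem compl_singleton (h : P.Admissible k v₀) {v : V} (hv : v ∈ P.verts) :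
    cut P.edges (P.verts \ {v}) = cut P.edges {v} ∧
    P.rdeg P.verts = P.rdeg (P.verts \ {v}) + P.rdeg {v} ∧
    P.demand P.verts = P.demand (P.verts \ {v}) + P.target v := by
  have hdisj : Disjoint (P.verts \ {v}) {v} := Finset.sdiff_disjoint
  have hW : P.verts = (P.verts \ {v}) ∪ {v} := by
    rw [Finset.sdiff_union_of_subset (by simpa using hv)]
  refine ⟨cut_compl h.edges_mem fun u hu ↦ by simp [hu], ?_, ?_⟩
  · conv_lhs => rw [hW, rdeg_union hdisj]
  · conv_lhs => rw [hW, demand_union hdisj, demand_singleton]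

/-- The degree of `v` into the remaining vertices is large, as all vertices but `v` form a set with
a strict cut. -/
theorem cut_singleton_ge (h : P.Admissible k v₀) (hs : P.StrictCuts k)
    (hc : 3 ≤ P.verts.card) {v : V} (hv : v ∈ P.verts) :
    2 * k + circNorm k (P.demand (P.verts \ {v})) + P.rdeg {v} ≤
      cut P.edges {v} + P.rdeg P.verts := by
  obtain ⟨h1, h2, -⟩ := compl_singleton h hv
  have := hs (P.verts \ {v}) Finset.sdiff_subset
    (by rw [Finset.card_sdiff_of_subset (by simpa using hv), Finset.card_singleton]; omega)
    (fun he ↦ by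
      rw [← he] at hv
      simp at hv)
  rw [deg_eq, h1] at this
  omega

/-- A vertex of zero target may be the exempt one, so its degree can be reduced freely by lifting.
The complement of `v` has a strict cut, which with the root condition leaves at least two more
non-loop edges than root arcs at `v`. -/
theorem solvable_of_target_zero (hk : 0 < k) (h : P.Admissible k v₀) (hs : P.StrictCuts k)
    (hc : 3 ≤ P.verts.card) {v : V} (hv : v ∈ P.verts) (hv0 : circNorm k (P.target v) = 0)
    (h1 : ∀ w ∈ P.verts, w ≠ v → 2 * k - 2 + circNorm k (P.target w) ≤ P.deg {w})
    (ihE : ∀ Q : RootedGraph V, Q.verts = P.verts → Q.edges.card < P.edges.card →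
      (∃ v, Q.Admissible k v) → Q.Solvable k) : P.Solvable k := by
  have hge := cut_singleton_ge h hs hc hv
  obtain ⟨-, -, hd⟩ := compl_singleton h hv
  have hadd := circNorm.add_le hk (P.demand (P.verts \ {v})) (P.target v)
  rw [← hd, hv0] at hadd
  have hroot := h.root
  have hr := P.rdeg_nonneg {v}
  by_cases hr0 : 0 < P.rdeg {v}
  · exact solvable_of_lift_root hk h hs h1 (Or.inl hv0) (by omega) hr0 ihE
  obtain ⟨v', u, he, hv', hu⟩ := exists_crossing (E := P.edges) (A := {v}) (by omega)
  obtain rfl : v' = v := by simpa using hv'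
  have huv : u ≠ v' := by simpa using hu
  obtain ⟨E₁, hE₁⟩ := Multiset.exists_cons_of_mem he
  have huW : u ∈ P.verts := h.edges_mem _ he u (by simp)
  obtain ⟨w, hw, hwv, huw⟩ : ∃ w, s(v', w) ∈ E₁ ∧ w ≠ v' ∧
      (u = w → 2 * k + circNorm k (P.target u) ≤ P.deg {u}) := by
    by_cases hall : ∃ w, s(v', w) ∈ E₁ ∧ w ≠ v' ∧ u ≠ w
    · obtain ⟨w, h2, h3, h4⟩ := hall
      exact ⟨w, h2, h3, fun h ↦ absurd h h4⟩
    · push Not at hall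
      have hcut : cut P.edges {v'} = 1 + cut E₁ {v'} := by
        rw [hE₁, cut_cons, crossing_mk, ind_singleton_self, ind_singleton_of_ne huv]
        simp
      obtain ⟨v'', w, he', hv'', hw⟩ := exists_crossing (E := E₁) (A := {v'}) (by omega)
      obtain rfl : v'' = v' := by simpa using hv''
      have hw : w ≠ v'' := by simpa using hw
      refine ⟨w, he', hw, fun _ ↦ ?_⟩
      -- When all edges from `v` lead to `u`, lifting two of them makes a loop and costs `u` two in
      -- degree. The strict cut around `{u, v}`, whose demand has the norm of the target of `u`,
      -- shows that `u` can afford this.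
      have h2 := cut_eq_cut_pair_add_cut (E := P.edges) huv fun w hw ↦ by
        rw [hE₁, Multiset.mem_cons] at hw
        rcases hw with hw | hw
        · rw [Sym2.eq_iff] at hw
          grind
        · by_cases hwv : w = v''
          · exact Or.inl hwv
          · exact Or.inr (hall w hw hwv).symm
      have hdisj : Disjoint {u} ({v''} : Finset V) := by simpa using huv
      have h3 := hs {u, v''} (by simp [Finset.insert_subset_iff, huW, hv])
        (by rw [Finset.card_pair huv]) (fun h ↦ by
          rw [← h, Finset.card_pair huv] at hc
          omega)
      have h4 : P.rdeg {u, v''} = P.rdeg {u} + P.rdeg {v''} := rdeg_union hdisj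
      have h5 : P.demand {u, v''} = P.target u + P.target v'' := by
        rw [← demand_singleton, ← demand_singleton]
        exact demand_union hdisj
      have h6 := circNorm.add_le hk (P.target u + P.target v'') (-P.target v'')
      rw [circNorm.neg hk, hv0, add_neg_cancel_right] at h6
      rw [deg_eq, h4, h5] at h3
      rw [deg_eq]
      omega
  obtain ⟨E, hE⟩ := Multiset.exists_cons_of_mem hw
  rw [hE] at hE₁
  obtain ⟨hadm, hsol⟩ := lift_pair hk h hs h1 hv0 hE₁ huv hwv huw
  exact hsol (ihE _ rfl (by simp [modify, hE₁]) ⟨_, hadm⟩)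

theorem cut_singleton_pos (hk : 2 ≤ k) (h : P.Admissible k v₀) (hs : P.StrictCuts k)
    (hc : 3 ≤ P.verts.card)
    (h1 : ∀ v ∈ P.verts, 2 * k - 2 + circNorm k (P.target v) ≤ P.deg {v}) {v : V}
    (hv : v ∈ P.verts) : 0 < cut P.edges {v} := by
  have h2 := cut_singleton_ge h hs hc hv
  have h3 := h1 v hv
  have h4 := h.root
  have h5 := circNorm.le (k := k) (x := P.demand P.verts) (by omega)
  have h6 := circNorm.nonneg (k := k) (x := P.demand (P.verts \ {v}))
  have h7 := circNorm.nonneg (k := k) (x := P.target v)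
  rw [deg_eq] at h3
  omega

theorem exists_neighbor (h : P.Admissible k v₀) {v : V} (hv : 0 < cut P.edges {v}) :
    ∃ w ∈ P.verts, v ≠ w ∧ s(v, w) ∈ P.edges := by
  obtain ⟨v', w, he, hv', hw⟩ := exists_crossing hv
  obtain rfl : v' = v := by simpa using hv'
  exact ⟨w, h.edges_mem _ he w (by simp), by simpa [eq_comm] using hw, he⟩

/-- All targets lie strictly between `0` and `k` modulo `2k`, so every vertex gains only from an
outgoing arc. Turning an edge into a root arc, or deleting an outgoing root arc, lowers the total
demand by one, which the root condition may or may not permit. One extremal configuration resists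
both moves; there new root arcs carry a vertex past the antipode `k`. -/
theorem solvable_of_pos (hk : 2 ≤ k) (h : P.Admissible k v₀) (hs : P.StrictCuts k)
    (hc : 3 ≤ P.verts.card)
    (h1 : ∀ v ∈ P.verts, 2 * k - 2 + circNorm k (P.target v) ≤ P.deg {v})
    (hP : ∀ v ∈ P.verts, circNorm k (P.target v - 1) = circNorm k (P.target v) - 1)
    (hQ : ∀ v ∈ P.verts, circNorm k (P.target v + 1) ≠ circNorm k (P.target v) - 1)
    (ihE : ∀ Q : RootedGraph V, Q.verts = P.verts → Q.edges.card < P.edges.card →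
      (∃ v, Q.Admissible k v) → Q.Solvable k)
    (ihR : ∀ Q : RootedGraph V, Q.verts = P.verts → Q.edges.card = P.edges.card →
      Q.inn.card + Q.out.card < P.inn.card + P.out.card →
      (∃ v, Q.Admissible k v) → Q.Solvable k) : P.Solvable k := by
  have hk0 : 0 < k := by omega
  have hnb : ∀ v ∈ P.verts, ∃ w ∈ P.verts, v ≠ w ∧ s(v, w) ∈ P.edges := fun v hv ↦
    exists_neighbor h (cut_singleton_pos hk h hs hc h1 hv)
  obtain ⟨x, hx⟩ : P.verts.Nonempty := by
    rw [← Finset.card_pos]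
    omega
  obtain ⟨y, hy, hxy, he⟩ := hnb x hx
  obtain ⟨E, hE⟩ := Multiset.exists_cons_of_mem he
  have hroot := h.root
  by_cases hA : P.rdeg P.verts + 1 ≤ 2 * k - 2 + circNorm k (P.demand P.verts - 1)
  · obtain ⟨hadm, hsol⟩ := reroute hk0 h hs h1 hE hxy (hP x hx) hA
    exact hsol (ihE _ rfl (by simp [modify, hE]) ⟨_, hadm⟩)
  have hpar := h.parity P.verts subset_rfl
  rw [deg_eq, cut_verts h] at hpar
  have hpar' := circNorm.parity hk0 (P.demand P.verts)
  have hsub := circNorm.sub_one hk0 (P.demand P.verts)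
  by_cases hO : 0 < mass P.out P.verts
  · obtain ⟨v, hv, hvW⟩ := exists_mem_of_mass_pos hO
    obtain ⟨O, hO⟩ := Multiset.exists_cons_of_mem hv
    obtain ⟨w, _, hvw, _⟩ := hnb v hvW
    obtain ⟨hadm, hsol⟩ := delete_root_arc hk0 h hs h1 hO hvW hvw (hP v hvW) (by omega)
    exact hsol (ihR _ rfl rfl (by simp [modify, hO]) ⟨_, hadm⟩)
  have hO : mass P.out P.verts = 0 := by
    have := mass_nonneg P.out P.verts
    omega
  obtain ⟨c, hc'⟩ := h.sum
  have hq : P.rootNet P.verts = -P.rdeg P.verts := by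
    simp only [rootNet, rdeg, hO]
    ring
  rw [hq] at hc'
  have hn : circNorm k (P.demand P.verts) = circNorm k (P.rdeg P.verts) := by
    rw [← circNorm.neg hk0 (P.rdeg P.verts)]
    exact circNorm.congr ⟨c, by linear_combination hc'⟩
  have hqn : P.rdeg P.verts = 2 * k - 2 + circNorm k (P.demand P.verts) := by omega
  have hle := circNorm.le (k := k) (x := P.demand P.verts) hk0
  have hnn := circNorm.nonneg (k := k) (x := P.demand P.verts)
  -- All root arcs enter the graph and the root condition is tight, so the norm `n` of the total
  -- demand satisfies `n = |n - 2|`.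
  have hn1 : circNorm k (P.demand P.verts) = 1 := by
    rw [circNorm.congr (x := P.rdeg P.verts) (y := circNorm k (P.demand P.verts) - 2)
      ⟨1, by linear_combination hqn⟩, circNorm.eq_of_abs_le (x := circNorm k (P.demand P.verts) - 2)
      hk0 (by rw [abs_le]; omega)] at hn
    rcases abs_cases (circNorm k (P.demand P.verts) - 2) with ⟨h3, _⟩ | ⟨h3, _⟩ <;> omega
  obtain ⟨h3, h4, h5⟩ := circNorm.congr_self hk0 (hP x hx) (hQ x hx)
  -- Here `t` is the distance from the target of `x` to `k`. The new root arcs raise the root degree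
  -- and the norm of the total demand equally, from `1` to `1 + t ≤ k`.
  obtain ⟨t, ht⟩ : ∃ t : ℕ, circNorm k (P.target x) = k - t :=
    ⟨(k - circNorm k (P.target x)).toNat, by omega⟩
  have htc : circNorm k (P.demand P.verts + t) = 1 + t := by
    rw [circNorm.congr (y := 1 + t) ⟨c - 1, by linear_combination hc' - hqn - hn1⟩,
      circNorm.eq_of_abs_le hk0 (by rw [abs_le]; omega), abs_of_nonneg (by omega)]
  obtain ⟨hadm, hsol⟩ := add_root_arcs_delete_arc (t := t) (by omega) h hs h1 hE hxy (by omega)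
    (by omega) (by
      rw [ht] at h3
      convert h3 using 1
      ring) ht (hP y hy) (by omega)
  exact hsol (ihE _ rfl (by simp [modify, hE]) ⟨_, hadm⟩)

theorem solvable_step (hk : 2 ≤ k) (h : P.Admissible k v₀) (hc : 2 ≤ P.verts.card)
    (ihV : ∀ Q : RootedGraph V, 2 ≤ Q.verts.card → Q.verts.card < P.verts.card →
      (∃ v, Q.Admissible k v) → Q.Solvable k)
    (ihE : ∀ Q : RootedGraph V, Q.verts = P.verts → Q.edges.card < P.edges.card →
      (∃ v, Q.Admissible k v) → Q.Solvable k)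
    (ihR : ∀ Q : RootedGraph V, Q.verts = P.verts → Q.edges.card = P.edges.card →
      Q.inn.card + Q.out.card < P.inn.card + P.out.card →
      (∃ v, Q.Admissible k v) → Q.Solvable k) : P.Solvable k := by
  have hk0 : 0 < k := by omega
  by_cases hc2 : P.verts.card = 2
  · exact solvable_of_card_two hk hc2 h ihE
  by_cases hs : P.StrictCuts k
  swap
  · unfold StrictCuts at hs
    push Not at hs
    obtain ⟨A, hA, hA2, hne, hlt⟩ := hs
    have h2 := h.parity A hA
    have h3 := circNorm.parity hk0 (P.demand A)
    exact solvable_of_tight h hA hA2 hne (by omega) ihV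
  have hcut : ∀ v ∈ P.verts, 2 * k - 2 + circNorm k (P.target v) ≤ P.deg {v} ∨
      (v = v₀ ∧ circNorm k (P.target v₀) = 0) := fun v hv ↦ by
    have := h.cut {v} (by simpa using hv) (by simp) (fun he ↦ by
      rw [← he, Finset.card_singleton] at hc
      omega)
    rwa [demand_singleton, Finset.singleton_inj] at this
  by_cases h0 : ∃ v ∈ P.verts, circNorm k (P.target v) = 0
  -- Lifting exempts its own vertex, so the vertex already exempt must be preferred.
  · by_cases h00 : v₀ ∈ P.verts ∧ circNorm k (P.target v₀) = 0
    · exact solvable_of_target_zero hk0 h hs (by omega) h00.1 h00.2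
        (fun w hw hwv ↦ (hcut w hw).resolve_right fun h ↦ hwv h.1) ihE
    · obtain ⟨v, hv, hv0⟩ := h0
      refine solvable_of_target_zero hk0 h hs (by omega) hv hv0
        (fun w hw hwv ↦ (hcut w hw).resolve_right ?_) ihE
      rintro ⟨rfl, h⟩
      exact h00 ⟨hw, h⟩
  push Not at h0
  have h1 : ∀ v ∈ P.verts, 2 * k - 2 + circNorm k (P.target v) ≤ P.deg {v} := fun v hv ↦
    (hcut v hv).resolve_right fun h ↦ h0 v hv (h.1 ▸ h.2)
  by_cases hE : ∃ x y, s(x, y) ∈ P.edges ∧ x ≠ y ∧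
      circNorm k (P.target x - 1) = circNorm k (P.target x) - 1 ∧
      circNorm k (P.target y + 1) = circNorm k (P.target y) - 1
  · obtain ⟨x, y, he, hxy, hx, hy⟩ := hE
    obtain ⟨E, hE⟩ := Multiset.exists_cons_of_mem he
    obtain ⟨hadm, hsol⟩ := delete_arc hk0 h hs h1 hE hxy hx hy
    exact hsol (ihE _ rfl (by simp [modify, hE]) ⟨_, hadm⟩)
  push Not at hE
  set A := P.verts.filter fun v ↦ circNorm k (P.target v - 1) = circNorm k (P.target v) - 1
    with hAdef
  have hAsub : A ⊆ P.verts := Finset.filter_subset _ _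
  by_cases hAW : A = P.verts
  · have hP : ∀ v ∈ P.verts, circNorm k (P.target v - 1) = circNorm k (P.target v) - 1 :=
      fun v hv ↦ (Finset.mem_filter.1 (hAW ▸ hv : v ∈ A)).2
    refine solvable_of_pos hk h hs (by omega) h1 hP (fun v hv ↦ ?_) ihE ihR
    obtain ⟨w, hw, hvw, he⟩ := exists_neighbor h
      (cut_singleton_pos hk h hs (by omega) h1 hv)
    exact hE w v (Sym2.eq_swap ▸ he) hvw.symm (hP w hw)
  by_cases hA0 : A = ∅
  · have hP : ∀ v ∈ P.verts, circNorm k (P.target v - 1) ≠ circNorm k (P.target v) - 1 := by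
      intro v hv hP
      have : v ∈ A := Finset.mem_filter.2 ⟨hv, hP⟩
      simp [hA0] at this
    have hQ : ∀ v ∈ P.verts, circNorm k (P.target v + 1) = circNorm k (P.target v) - 1 :=
      fun v hv ↦ (circNorm.sub_one_or_add_one hk0 (h0 v hv)).resolve_left (hP v hv)
    have e1 : ∀ v, circNorm k (P.reverse.target v - 1) = circNorm k (P.target v + 1) := fun v ↦ by
      rw [← circNorm.neg hk0 (P.target v + 1)]
      congr 1
      simp only [RootedGraph.reverse]
      ring
    have e2 : ∀ v, circNorm k (P.reverse.target v + 1) = circNorm k (P.target v - 1) := fun v ↦ by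
      rw [← circNorm.neg hk0 (P.target v - 1)]
      congr 1
      simp only [RootedGraph.reverse]
      ring
    have e3 : ∀ v, circNorm k (P.reverse.target v) = circNorm k (P.target v) :=
      fun v ↦ circNorm.neg hk0 _
    refine Solvable.of_reverse (solvable_of_pos hk (h.reverse hk0) (hs.reverse hk0)
      (by change 3 ≤ P.verts.card; omega) ?_ ?_ ?_ ihE ?_)
    · intro v hv
      rw [e3, reverse_deg]
      exact h1 v hv
    · intro v hv
      rw [e1, e3]
      exact hQ v hv
    · intro v hv
      rw [e2, e3]
      exact hP v hv
    · intro Q hQ1 hQ2 hQ3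
      refine ihR Q hQ1 hQ2 ?_
      rw [add_comm P.inn.card]
      exact hQ3
  -- No edge joins the two classes of residues, so both cuts consist of root arcs alone. Adding
  -- their lower bounds gives a root degree of at least `2(2k - 2)` plus both norms, too much for
  -- the root condition.
  exfalso
  have hBne : P.verts \ A ≠ P.verts := fun he ↦ by
    obtain ⟨a, ha⟩ := Finset.nonempty_iff_ne_empty.2 hA0
    have := he ▸ hAsub ha
    simp [ha] at this
  have hcutA : cut P.edges A = 0 := cut_eq_zero fun x y he hx ↦ by
    have hxW := hAsub hx
    have hyW := h.edges_mem _ he y (by simp)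
    by_contra hy
    have hyP : circNorm k (P.target y - 1) ≠ circNorm k (P.target y) - 1 := fun h ↦
      hy (Finset.mem_filter.2 ⟨hyW, h⟩)
    refine hE x y he ?_ (Finset.mem_filter.1 hx).2
      ((circNorm.sub_one_or_add_one hk0 (h0 y hyW)).resolve_left hyP)
    rintro rfl
    exact hy hx
  have hcutB : cut P.edges (P.verts \ A) = 0 := by
    rw [cut_compl (B := A) h.edges_mem fun v hv ↦ by simp [hv], hcutA]
  have hdisj : Disjoint (P.verts \ A) A := Finset.sdiff_disjoint
  have hWU : P.verts = (P.verts \ A) ∪ A := by rw [Finset.sdiff_union_of_subset hAsub]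
  have hr : P.rdeg P.verts = P.rdeg (P.verts \ A) + P.rdeg A := by
    conv_lhs => rw [hWU, rdeg_union hdisj]
  have hd : P.demand P.verts = P.demand (P.verts \ A) + P.demand A := by
    conv_lhs => rw [hWU, demand_union hdisj]
  have hall : ∀ B ⊆ P.verts, B ≠ ∅ → B ≠ P.verts →
      2 * k - 2 + circNorm k (P.demand B) ≤ P.deg B := fun B hB hB0 hBW ↦
    (h.cut B hB (Finset.nonempty_iff_ne_empty.2 hB0) hBW).resolve_right fun ⟨h2, h3⟩ ↦
      h0 v₀ (hB (by simp [h2])) h3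
  have hA' := hall A hAsub hA0 hAW
  have hB' := hall (P.verts \ A) Finset.sdiff_subset (fun he ↦ hAW
    (hAsub.antisymm (Finset.sdiff_eq_empty_iff_subset.1 he))) hBne
  have hroot := h.root
  have hadd := circNorm.add_le hk0 (P.demand (P.verts \ A)) (P.demand A)
  rw [deg_eq, hcutA] at hA'
  rw [deg_eq, hcutB] at hB'
  rw [hd, hr] at hroot
  omega

/-- An admissible rooted graph has an orientation with the prescribed net outdegrees modulo
`2 * k`, all less than `2 * k` in absolute value. -/
theorem Admissible.solvable (hk : 2 ≤ k) (h : ∃ v, P.Admissible k v) (hc : 2 ≤ P.verts.card) :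
    P.Solvable k := by
  suffices H : ∀ n m r : ℕ, ∀ Q : RootedGraph V, Q.verts.card = n → Q.edges.card = m →
      Q.inn.card + Q.out.card = r → 2 ≤ n → (∃ v, Q.Admissible k v) → Q.Solvable k from
    H _ _ _ P rfl rfl rfl hc h
  intro n
  induction n using Nat.strong_induction_on with | _ n ihn =>
  intro m
  induction m using Nat.strong_induction_on with | _ m ihm =>
  intro r
  induction r using Nat.strong_induction_on with | _ r ihr =>
  rintro Q rfl rfl rfl hc ⟨v, hv⟩
  exact solvable_step hk hv hc
    (fun R h1 h2 h3 ↦ ihn _ h2 _ _ R rfl rfl rfl h1 h3)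
    (fun R h1 h2 h3 ↦ ihm _ h2 _ R (by rw [h1]) rfl rfl hc h3)
    (fun R h1 h2 h3 h4 ↦ ihr _ h3 R (by rw [h1]) h2 rfl hc h4)

/-- Highly edge-connected rooted graphs of small root degree have an orientation with the
prescribed net outdegrees, in which moreover one extreme value is avoided at a given vertex. -/
theorem exists_solution (hk : 2 ≤ k) {z : V} (hz : z ∈ P.verts)
    (he : ∀ e ∈ P.edges, ∀ v ∈ e, v ∈ P.verts)
    (hpar : ∀ A ⊆ P.verts, (2 : ℤ) ∣ P.demand A - P.deg A)
    (hsum : (2 * k : ℤ) ∣ P.demand P.verts - P.rootNet P.verts)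
    (hroot : P.rdeg P.verts ≤ 2 * k - 2) (heven : (2 : ℤ) ∣ P.rdeg P.verts)
    (hcut : ∀ A ⊆ P.verts, A.Nonempty → A ≠ P.verts → 3 * k - 3 ≤ P.deg A) {η : ℤ}
    (hη : η = 1 ∨ η = -1) :
    ∃ D, underlying D = P.edges ∧ (∀ v ∈ P.verts,
      (2 * k : ℤ) ∣ net D {v} + P.rootNet {v} - P.target v ∧
        |net D {v} + P.rootNet {v}| ≤ 2 * k - 1) ∧
      η * (net D {z} + P.rootNet {z}) ≠ 2 * k - 1 := by
  have hk0 : 0 < k := by omega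
  -- The norm is at most `k`. Only norm `k` needs more than `3k - 3`, and then parity excludes a cut
  -- of exactly `3k - 3` edges.
  have hcut' : ∀ A ⊆ P.verts, A.Nonempty → A ≠ P.verts →
      2 * k - 2 + circNorm k (P.demand A) ≤ P.deg A := fun A hA h1 h2 ↦ by
    have h3 := hcut A hA h1 h2
    have h4 := hpar A hA
    have h5 := circNorm.parity hk0 (P.demand A)
    have h6 := circNorm.le (k := k) (x := P.demand A) hk0
    omega
  have hadm : P.Admissible k z := ⟨he, hpar, hsum, by
    have := circNorm.nonneg (k := k) (x := P.demand P.verts)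
    omega, fun A h1 h2 h3 ↦ Or.inl (hcut' A h1 h2 h3)⟩
  by_cases hc : P.verts.card = 1
  · obtain ⟨w, hw⟩ := Finset.card_eq_one.1 hc
    obtain rfl : z = w := by simpa [hw] using hz
    obtain ⟨D, hD⟩ := exists_underlying_eq P.edges
    have h0 := net_verts hadm hD
    rw [hw] at h0 hsum hroot heven
    rw [demand_singleton] at hsum
    have h1 := abs_rootNet_le (P := P) {z}
    refine ⟨D, hD, fun v hv ↦ ?_, ?_⟩
    · obtain rfl : v = z := by simpa [hw] using hv
      rw [h0, zero_add]
      obtain ⟨c, hc⟩ := hsum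
      exact ⟨⟨-c, by linear_combination -hc⟩, by omega⟩
    · rw [h0, zero_add]
      have : (2 : ℤ) ∣ P.rootNet {z} := by
        simp only [rootNet, rdeg] at *
        omega
      rcases hη with rfl | rfl <;> omega
  have hc2 : 2 ≤ P.verts.card := by
    have := Finset.card_pos.2 ⟨z, hz⟩
    omega
  -- The forbidden value `η * (2k - 1)` is congruent to `-η`, so only this residue needs care. An
  -- extra root arc at `z` makes the new target zero modulo `2k`, hence the new net outdegree
  -- exactly zero.
  by_cases hb : (2 * k : ℤ) ∣ P.target z + η
  · set Q : RootedGraph V := P.modify P.edges (if η = 1 then P.inn else z ::ₘ P.inn)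
      (if η = 1 then z ::ₘ P.out else P.out) z z η 0 with hQ
    have hd : ∀ A, Q.demand A = P.demand A + η * ind A z := fun A ↦ by
      rw [hQ, modify_demand]
      ring
    have hn : ∀ A, Q.rootNet A = P.rootNet A + η * ind A z := fun A ↦ by
      rw [hQ, modify_rootNet, rootNet]
      rcases hη with rfl | rfl
      · simp; ring
      · simp; ring
    have hr : ∀ A, Q.rdeg A = P.rdeg A + ind A z := fun A ↦ by
      rw [hQ, modify_rdeg, rdeg]
      rcases hη with rfl | rfl
      · simp; ring
      · simp; ring
    have hdeg : ∀ A, Q.deg A = P.deg A + ind A z := fun A ↦ by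
      rw [deg_eq, deg_eq, hr, add_assoc]
      rfl
    have hQadm : Q.Admissible k z := by
      have hparQ : ∀ A ⊆ P.verts, (2 : ℤ) ∣ Q.demand A - Q.deg A := fun A hA ↦ by
        have := hpar A hA
        rw [hd, hdeg]
        rcases hη with rfl | rfl <;> omega
      refine ⟨he, hparQ, ?_, ?_, fun A hA h1 h2 ↦ Or.inl ?_⟩
      · change _ ∣ Q.demand P.verts - Q.rootNet P.verts
        rw [hd, hn]
        convert hsum using 1
        ring
      -- The root degree was even and is now odd, so the total demand is odd and its norm at least
      -- `1`. This pays for the extra arc.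
      · change Q.rdeg P.verts ≤ 2 * k - 2 + circNorm k (Q.demand P.verts)
        have h1 := hparQ P.verts subset_rfl
        have h2 := hpar P.verts subset_rfl
        have h3 := circNorm.parity hk0 (Q.demand P.verts)
        have h4 := circNorm.nonneg (k := k) (x := Q.demand P.verts)
        rw [deg_eq] at h1 h2
        rw [cut_verts hadm] at h2
        rw [show Q.edges = P.edges from rfl, cut_verts hadm] at h1
        rw [hr, ind_of_mem hz] at h1 ⊢
        omega
      · have h3 := hcut' A hA h1 h2
        have h4 := circNorm.add_le_abs hk0 (P.demand A) (η * ind A z)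
        have h5 : |η * ind A z| = ind A z := by
          have := ind_nonneg A z
          rcases hη with rfl | rfl <;> simp [abs_of_nonneg this]
        rw [hd, hdeg]
        omega
    obtain ⟨D, hD, h1⟩ := Admissible.solvable hk ⟨z, hQadm⟩ hc2
    have hzN : net D {z} + P.rootNet {z} = -η := by
      obtain ⟨h2, h3⟩ := h1 z hz
      rw [hn, ind_singleton_self] at h2 h3
      have e : Q.target z = P.target z + η := by
        simp [hQ, modify, ind_singleton_self]
      rw [e] at h2
      have h4 : (2 * k : ℤ) ∣ net D {z} + (P.rootNet {z} + η * 1) := by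
        have := dvd_add h2 hb
        rwa [sub_add_cancel] at this
      have h5 := Int.eq_zero_of_abs_lt_dvd h4 (by omega)
      omega
    refine ⟨D, hD, fun v hv ↦ ?_, ?_⟩
    · by_cases hvz : v = z
      · subst hvz
        rw [hzN]
        refine ⟨?_, ?_⟩
        · obtain ⟨c, hc⟩ := hb
          exact ⟨-c, by linear_combination -hc⟩
        · rcases hη with rfl | rfl <;> norm_num <;> omega
      · have := h1 v hv
        rw [hn, ind_singleton_of_ne (Ne.symm hvz)] at this
        have e : Q.target v = P.target v := by
          simp [hQ, modify, ind_singleton_of_ne (Ne.symm hvz)]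
        rw [e] at this
        simpa using this
    · rw [hzN]
      rcases hη with rfl | rfl <;> omega
  · obtain ⟨D, hD, h1⟩ := Admissible.solvable hk ⟨z, hadm⟩ hc2
    refine ⟨D, hD, h1, fun h2 ↦ hb ?_⟩
    obtain ⟨c, hc⟩ := (h1 z hz).1
    rcases hη with rfl | rfl
    · exact ⟨1 - c, by linear_combination h2 - hc⟩
    · exact ⟨-1 - c, by linear_combination -h2 - hc⟩

end RootedGraph

end RootedGraphs

/-! ### Degrees, cuts and trails in terms of chosen edge ends. -/

section FactorGraphs

variable {α β : Type*}

/-- `F` is the set of edges of `H`, and `en` lists the two ends of each of them. -/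
structure HasEnds (H : Graph α β) (F : Finset β) (en : β → α × α) : Prop where
  coe_eq : (F : Set β) = H.edgeSet
  isLink : ∀ e ∈ F, H.IsLink e (en e).1 (en e).2

namespace HasEnds

variable {H : Graph α β} {F : Finset β} {en : β → α × α}

theorem isLink_iff (h : HasEnds H F en) {e : β} {x y : α} :
    H.IsLink e x y ↔ e ∈ F ∧ (((en e).1 = x ∧ (en e).2 = y) ∨ ((en e).1 = y ∧ (en e).2 = x)) := by
  constructor
  · intro hl
    have he : e ∈ F := by
      rw [← Finset.mem_coe, h.coe_eq]
      exact hl.edge_mem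
    exact ⟨he, (h.isLink e he).isLink_iff.1 hl⟩
  · rintro ⟨he, h'⟩
    exact (h.isLink e he).isLink_iff.2 h'

/-- The number of times `v` occurs as an end of an edge with ends `p`. -/
def _root_.incidence [DecidableEq α] (p : α × α) (v : α) : ℤ := ind {v} p.1 + ind {v} p.2

theorem degree_eq [DecidableEq α] (h : HasEnds H F en) (v : α) :
    (ModFactor.degree H v : ℤ) = ∑ e ∈ F, incidence (en e) v := by
  classical
  have h1 : {e | H.IsNonloopAt e v} =
      ((F.filter fun e ↦ ((en e).1 = v ∧ (en e).2 ≠ v) ∨ ((en e).2 = v ∧ (en e).1 ≠ v) :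
        Finset β) : Set β) := by
    ext e
    simp only [Graph.IsNonloopAt, h.isLink_iff, Set.mem_ofPred_eq, Finset.coe_filter]
    constructor
    · rintro ⟨y, hy, he, ⟨h1, h2⟩ | ⟨h1, h2⟩⟩
      · exact ⟨he, Or.inl ⟨h1, h2 ▸ hy⟩⟩
      · exact ⟨he, Or.inr ⟨h2, h1 ▸ hy⟩⟩
    · rintro ⟨he, ⟨h1, h2⟩ | ⟨h1, h2⟩⟩
      · exact ⟨_, h2, he, Or.inl ⟨h1, rfl⟩⟩
      · exact ⟨_, h2, he, Or.inr ⟨rfl, h1⟩⟩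
  have h2 : {e | H.IsLoopAt e v} =
      ((F.filter fun e ↦ (en e).1 = v ∧ (en e).2 = v : Finset β) : Set β) := by
    ext e
    simp only [Graph.IsLoopAt, h.isLink_iff, Set.mem_ofPred_eq, Finset.coe_filter]
    grind
  rw [ModFactor.degree, h1, h2, Set.ncard_coe_finset, Set.ncard_coe_finset, Finset.card_filter,
    Finset.card_filter]
  push_cast
  rw [Finset.mul_sum, ← Finset.sum_add_distrib]
  refine Finset.sum_congr rfl fun e _ ↦ ?_
  simp only [incidence, ind_eq, Finset.mem_singleton]
  by_cases h3 : (en e).1 = v <;> by_cases h4 : (en e).2 = v <;> simp [h3, h4]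

open Classical in
theorem edgesInside_eq (h : HasEnds H F en) (A : Set α) :
    ModFactor.edgesInside H A = (F.filter fun e ↦ (en e).1 ∈ A ∧ (en e).2 ∈ A).card := by
  rw [← Set.ncard_coe_finset, ModFactor.edgesInside]
  congr 1
  ext e
  simp only [h.isLink_iff, Set.mem_ofPred_eq, Finset.coe_filter]
  constructor
  · rintro ⟨x, hx, y, hy, he, ⟨rfl, rfl⟩ | ⟨rfl, rfl⟩⟩
    · exact ⟨he, hx, hy⟩
    · exact ⟨he, hy, hx⟩
  · rintro ⟨he, hx, hy⟩
    exact ⟨_, hx, _, hy, he, Or.inl ⟨rfl, rfl⟩⟩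

theorem cutSize_eq [DecidableEq α] (h : HasEnds H F en) (A : Finset α) :
    (ModFactor.cutSize H A : ℤ) = ∑ e ∈ F, |ind A (en e).1 - ind A (en e).2| := by
  classical
  have h1 : {e | ∃ x ∈ (A : Set α), ∃ y ∉ (A : Set α), H.IsLink e x y} =
      ((F.filter fun e ↦ ¬((en e).1 ∈ A ↔ (en e).2 ∈ A) : Finset β) : Set β) := by
    ext e
    simp only [h.isLink_iff, Set.mem_ofPred_eq, Finset.coe_filter, Finset.mem_coe]
    constructor
    · rintro ⟨x, hx, y, hy, he, ⟨rfl, rfl⟩ | ⟨rfl, rfl⟩⟩ <;> simp_all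
    · rintro ⟨he, hx⟩
      by_cases h1 : (en e).1 ∈ A
      · exact ⟨_, h1, _, by tauto, he, Or.inl ⟨rfl, rfl⟩⟩
      · exact ⟨(en e).2, by tauto, (en e).1, h1, he, Or.inr ⟨rfl, rfl⟩⟩
  rw [ModFactor.cutSize, h1, Set.ncard_coe_finset, Finset.card_filter]
  push_cast
  refine Finset.sum_congr rfl fun e _ ↦ ?_
  simp only [ind_eq]
  split_ifs <;> simp_all

theorem mono {F' : Finset β} {H' : Graph α β} (h : HasEnds H F en) (hle : H' ≤ H)
    (hF : (F' : Set β) = H'.edgeSet) : HasEnds H' F' en where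
  coe_eq := hF
  isLink e he := by
    have he' : e ∈ H'.edgeSet := by rwa [← hF]
    have : e ∈ F := by
      rw [← Finset.mem_coe, h.coe_eq]
      exact hle.edgeSet_mono he'
    exact (hle.isLink_iff he').2 (h.isLink e this)

end HasEnds

theorem exists_hasEnds [Nonempty α] (G : Graph α β) (hE : G.edgeSet.Finite) :
    ∃ F en, HasEnds G F en := by
  classical
  have h : ∀ e, ∃ p : α × α, e ∈ G.edgeSet → G.IsLink e p.1 p.2 := fun e ↦ by
    by_cases he : e ∈ G.edgeSet
    · obtain ⟨x, y, h⟩ := G.exists_isLink_of_mem_edgeSet he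
      exact ⟨(x, y), fun _ ↦ h⟩
    · exact ⟨Classical.arbitrary _, fun h ↦ absurd h he⟩
  choose en hen using h
  exact ⟨hE.toFinset, en, by simp, fun e he ↦ hen e (by simpa using he)⟩

/-- Orientations of indexed edges are given by signs. -/
theorem exists_sign {ι : Type*} [DecidableEq ι] [DecidableEq α] (en : ι → α × α) (J : Finset ι) :
    ∀ D, underlying D = J.val.map (fun j ↦ s((en j).1, (en j).2)) → ∃ ε : ι → ℤ,
      (∀ j, ε j = 1 ∨ ε j = -1) ∧
        ∀ A, net D A = ∑ j ∈ J, ε j * (ind A (en j).1 - ind A (en j).2) := by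
  induction J using Finset.induction_on with
  | empty =>
    intro D hD
    obtain rfl : D = 0 := by simpa [underlying] using hD
    exact ⟨fun _ ↦ 1, by simp, by simp⟩
  | insert i J hi ih =>
    intro D hD
    rw [Finset.insert_val_of_notMem hi, Multiset.map_cons] at hD
    obtain ⟨p, hp, hp'⟩ : ∃ p ∈ D, s(p.1, p.2) = s((en i).1, (en i).2) := by
      rw [← Multiset.mem_map]
      change _ ∈ underlying D
      simp [hD]
    obtain ⟨D, rfl⟩ := Multiset.exists_cons_of_mem hp
    rw [underlying_cons, hp', Multiset.cons_inj_right] at hD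
    obtain ⟨ε, h1, h2⟩ := ih D hD
    have key : ∀ s : ℤ, (s = 1 ∨ s = -1) →
        (∀ A, ind A p.1 - ind A p.2 = s * (ind A (en i).1 - ind A (en i).2)) →
        ∃ ε : ι → ℤ, (∀ j, ε j = 1 ∨ ε j = -1) ∧ ∀ A, net (p ::ₘ D) A =
          ∑ j ∈ insert i J, ε j * (ind A (en j).1 - ind A (en j).2) := by
      intro s hs hA
      refine ⟨Function.update ε i s, fun j ↦ ?_, fun A ↦ ?_⟩
      · by_cases hj : j = i
        · subst hj
          simpa using hs
        · simpa [hj] using h1 j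
      · rw [net_cons, Finset.sum_insert hi, hA, h2, Function.update_self]
        congr 1
        refine Finset.sum_congr rfl fun j hj ↦ ?_
        rw [Function.update_of_ne (by rintro rfl; exact hi hj)]
    rw [Sym2.eq_iff] at hp'
    rcases hp' with ⟨hp1, hp2⟩ | ⟨hp1, hp2⟩
    · exact key 1 (Or.inl rfl) fun A ↦ by rw [hp1, hp2]; ring
    · exact key (-1) (Or.inr rfl) fun A ↦ by rw [hp1, hp2]; ring

/-- Telescoping: an inner vertex of a trail lies between two edges of opposite sign. Only the two
ends survive. -/
theorem sum_alternating (n : ℕ) (w : Fin (n + 1) → ℤ) :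
    ∑ j : Fin n, (-1) ^ (j : ℕ) * (w j.castSucc + w j.succ) = w 0 - (-1) ^ n * w (Fin.last n) := by
  induction n with
  | zero => simp
  | succ n ih =>
    rw [Fin.sum_univ_castSucc]
    have := ih fun j ↦ w j.castSucc
    simp only [← Fin.castSucc_zero] at this ⊢
    simp only [Fin.val_castSucc, Fin.val_last, Fin.succ_castSucc, Fin.succ_last] at this ⊢
    rw [this]
    ring

section Trails

variable {T : Graph α β} {F : Finset β} {en : β → α × α} {n : ℕ} {Q : Fin n → ModFactor.Trail T}

theorem edge_injective (hQ : ModFactor.IsTrailDecomposition Q) :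
    Function.Injective fun p : Σ i : Fin n, Fin (Q i).size ↦ (Q p.1).edge p.2 := by
  rintro ⟨i, a⟩ ⟨j, b⟩ h
  change (Q i).edge a = (Q j).edge b at h
  obtain rfl : i = j := (hQ _ ((Q i).isLink a).edge_mem).unique ⟨a, rfl⟩ ⟨b, h.symm⟩
  rw [(Q i).edge_injective h]

theorem sum_trails (hF : HasEnds T F en) (hQ : ModFactor.IsTrailDecomposition Q) (φ : β → ℤ) :
    ∑ e ∈ F, φ e = ∑ i, ∑ j, φ ((Q i).edge j) := by
  rw [← Fintype.sum_sigma' fun i j ↦ φ ((Q i).edge j)]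
  symm
  refine Finset.sum_nbij (fun p ↦ (Q p.1).edge p.2) ?_ ((edge_injective hQ).injOn) ?_ (by simp)
  · rintro ⟨i, j⟩ -
    rw [← Finset.mem_coe, hF.coe_eq]
    exact ((Q i).isLink j).edge_mem
  · intro e he
    rw [hF.coe_eq] at he
    obtain ⟨i, ⟨j, hj⟩, -⟩ := hQ e he
    exact ⟨⟨i, j⟩, by simp, hj⟩

theorem add_ends_eq (hF : HasEnds T F en) (P : ModFactor.Trail T) (g : α → ℤ) (j : Fin P.size) :
    g (en (P.edge j)).1 + g (en (P.edge j)).2 = g (P.vert j.castSucc) + g (P.vert j.succ) := by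
  rcases (hF.isLink_iff.1 (P.isLink j)).2 with ⟨h1, h2⟩ | ⟨h1, h2⟩
  · rw [h1, h2]
  · rw [h1, h2, add_comm]

end Trails

end FactorGraphs

/-! ### Encoding edge signs as an orientation. -/

section FactorConstruction

set_option linter.unusedSectionVars false

variable {α β : Type*} [DecidableEq α] [DecidableEq β]

theorem mul_ind_singleton (σ : α → ℤ) (v x : α) : σ v * ind {v} x = σ x * ind {v} x := by
  by_cases h : x = v <;> simp [ind_eq, h]

theorem mass_map_val {ι : Type*} (S : Finset ι) (g : ι → α) (A : Finset α) :
    mass (S.val.map g) A = ∑ e ∈ S, ind A (g e) := by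
  unfold mass
  rw [Multiset.map_map]
  rfl

theorem cut_map_val {ι : Type*} (S : Finset ι) (g : ι → Sym2 α) (A : Finset α) :
    cut (S.val.map g) A = ∑ e ∈ S, crossing A (g e) := by
  unfold cut
  rw [Multiset.map_map]
  rfl

/-- The root arcs that encode the edges of `M`: those with `s e = 1` leave their ends. -/
def rootTails (en : β → α × α) (M : Finset β) (s : β → ℤ) : Multiset α :=
  (M.filter fun e ↦ s e = 1).val.map (fun e ↦ (en e).1) +
    (M.filter fun e ↦ s e = 1).val.map (fun e ↦ (en e).2)

theorem mass_rootTails (en : β → α × α) (M : Finset β) (s : β → ℤ) (A : Finset α) :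
    mass (rootTails en M s) A =
      ∑ e ∈ M, if s e = 1 then ind A (en e).1 + ind A (en e).2 else 0 := by
  rw [rootTails, mass_add, mass_map_val, mass_map_val, ← Finset.sum_add_distrib,
    Finset.sum_filter]

theorem mass_rootTails_add (en : β → α × α) (M : Finset β) {s : β → ℤ}
    (hs : ∀ e, s e = 1 ∨ s e = -1) (A : Finset α) :
    mass (rootTails en M fun e ↦ -s e) A + mass (rootTails en M s) A =
      ∑ e ∈ M, (ind A (en e).1 + ind A (en e).2) := by
  rw [mass_rootTails, mass_rootTails, ← Finset.sum_add_distrib]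
  refine Finset.sum_congr rfl fun e _ ↦ ?_
  rcases hs e with h | h <;> simp [h]

theorem mass_rootTails_sub (en : β → α × α) (M : Finset β) {s : β → ℤ}
    (hs : ∀ e, s e = 1 ∨ s e = -1) (A : Finset α) :
    mass (rootTails en M s) A - mass (rootTails en M fun e ↦ -s e) A =
      ∑ e ∈ M, s e * (ind A (en e).1 + ind A (en e).2) := by
  rw [mass_rootTails, mass_rootTails, ← Finset.sum_sub_distrib]
  refine Finset.sum_congr rfl fun e _ ↦ ?_
  rcases hs e with h | h <;> simp [h]

/-- A sum of signs in the possible range is attained by a subset. -/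
theorem exists_signs_sum_eq (M : Finset β) {s : β → ℤ} (t : ℤ)
    (h1 : -((M.filter fun e ↦ s e = -1).card : ℤ) ≤ t)
    (h2 : t ≤ ((M.filter fun e ↦ s e = 1).card : ℤ)) :
    ∃ χ : β → ℤ, (∀ e, χ e = 1 ∨ χ e = -1) ∧ (∑ e ∈ M, if χ e = 1 then s e else 0) = t := by
  have key : ∀ S ⊆ M, ∀ c : ℤ, (∀ e ∈ S, s e = c) → S.card * c = t →
      ∃ χ : β → ℤ, (∀ e, χ e = 1 ∨ χ e = -1) ∧ (∑ e ∈ M, if χ e = 1 then s e else 0) = t := by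
    intro S hS c hc ht
    refine ⟨fun e ↦ if e ∈ S then 1 else -1, fun e ↦ by by_cases h : e ∈ S <;> simp [h], ?_⟩
    rw [← Finset.sum_filter, ← ht]
    have e1 : (M.filter fun e ↦ (if e ∈ S then (1 : ℤ) else -1) = 1) = S := by
      ext e
      by_cases he : e ∈ S
      · simp [he, hS he]
      · simp [he]
    rw [e1, Finset.sum_congr rfl hc]
    simp
  rcases le_total 0 t with ht | ht
  · obtain ⟨S, hS, hc⟩ := Finset.exists_subset_card_eq
      (show t.toNat ≤ (M.filter fun e ↦ s e = 1).card by omega)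
    exact key S (hS.trans (Finset.filter_subset _ _)) 1
      (fun e he ↦ (Finset.mem_filter.1 (hS he)).2) (by omega)
  · obtain ⟨S, hS, hc⟩ := Finset.exists_subset_card_eq
      (show (-t).toNat ≤ (M.filter fun e ↦ s e = -1).card by omega)
    exact key S (hS.trans (Finset.filter_subset _ _)) (-1)
      (fun e he ↦ (Finset.mem_filter.1 (hS he)).2) (by omega)

section Trails

variable {T : Graph α β} {FT M C : Finset β} {en : β → α × α} {n : ℕ}
  {Q : Fin n → ModFactor.Trail T} {σ : α → ℤ}

theorem exists_trail_signs (hQ : ModFactor.IsTrailDecomposition Q) (ε : Fin n → ℤ) :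
    ∃ h : β → ℤ, ∀ i j, h ((Q i).edge j) = ε i * σ ((Q i).vert 0) * (-1) ^ (j : ℕ) :=
  ⟨Function.extend (fun p : Σ i : Fin n, Fin (Q i).size ↦ (Q p.1).edge p.2)
    (fun p ↦ ε p.1 * σ ((Q p.1).vert 0) * (-1) ^ (p.2 : ℕ)) 0,
    fun i j ↦ (edge_injective hQ).extend_apply _ _ ⟨i, j⟩⟩

theorem mem_trail (hF : HasEnds T FT en) (hQ : ModFactor.IsTrailDecomposition Q) {e : β}
    (he : e ∈ FT) : ∃ i j, (Q i).edge j = e := by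
  rw [← Finset.mem_coe, hF.coe_eq] at he
  obtain ⟨i, ⟨j, hj⟩, -⟩ := hQ e he
  exact ⟨i, j, hj⟩

/-- After telescoping, the last end carries `(-1) ^ size`, which `hpar` replaces by the product of
`σ` at the two ends. The factor `σ v` then makes the trail an arc from its first to its last vertex,
or the reverse, according to `ε`. -/
theorem sum_trail_signs (hF : HasEnds T FT en) (hQ : ModFactor.IsTrailDecomposition Q)
    (hσ : ∀ v, σ v = 1 ∨ σ v = -1)
    (hpar : ∀ i, σ ((Q i).vert 0) * σ ((Q i).vert (Fin.last _)) = (-1) ^ (Q i).size)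
    {ε : Fin n → ℤ} {h : β → ℤ}
    (hh : ∀ i j, h ((Q i).edge j) = ε i * σ ((Q i).vert 0) * (-1) ^ (j : ℕ)) (v : α) :
    σ v * ∑ e ∈ FT, h e * incidence (en e) v =
      ∑ i, ε i * (ind {v} ((Q i).vert 0) - ind {v} ((Q i).vert (Fin.last _))) := by
  rw [sum_trails hF hQ, Finset.mul_sum]
  refine Finset.sum_congr rfl fun i _ ↦ ?_
  have h1 : ∑ j, h ((Q i).edge j) * incidence (en ((Q i).edge j)) v =
      ε i * σ ((Q i).vert 0) * ∑ j : Fin (Q i).size, (-1) ^ (j : ℕ) *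
        (ind {v} ((Q i).vert j.castSucc) + ind {v} ((Q i).vert j.succ)) := by
    rw [Finset.mul_sum]
    refine Finset.sum_congr rfl fun j _ ↦ ?_
    rw [hh, incidence, add_ends_eq hF (Q i) (fun x ↦ ind {v} x) j]
    ring
  rw [h1, sum_alternating (Q i).size fun j ↦ ind {v} ((Q i).vert j), ← hpar]
  have h2 := mul_ind_singleton σ v ((Q i).vert 0)
  have h3 := mul_ind_singleton σ v ((Q i).vert (Fin.last _))
  have h4 : ∀ v, σ v * σ v = 1 := fun v ↦ by rcases hσ v with h | h <;> simp [h]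
  have h5 := h4 ((Q i).vert 0)
  have h6 := h4 ((Q i).vert (Fin.last _))
  linear_combination ε i * σ ((Q i).vert 0) * h2 + ε i * ind {v} ((Q i).vert 0) * h5 -
    ε i * σ ((Q i).vert (Fin.last _)) * σ ((Q i).vert 0) ^ 2 * h3 -
    ε i * σ ((Q i).vert (Fin.last _)) ^ 2 * ind {v} ((Q i).vert (Fin.last _)) * h5 -
    ε i * ind {v} ((Q i).vert (Fin.last _)) * h6

/-- The ends of the edges of `C` and of the trails. -/
def liftedEnds (en : β → α × α) (Q : Fin n → ModFactor.Trail T) : β ⊕ Fin n → α × α :=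
  Sum.elim en fun i ↦ ((Q i).vert 0, (Q i).vert (Fin.last _))

/-- The net outdegrees of the lifted orientation are the signed degree imbalances. -/
theorem net_eq_balance (hF : HasEnds T FT en) (hQ : ModFactor.IsTrailDecomposition Q)
    (hσ : ∀ v, σ v = 1 ∨ σ v = -1)
    (hpar : ∀ i, σ ((Q i).vert 0) * σ ((Q i).vert (Fin.last _)) = (-1) ^ (Q i).size)
    (hM : ∀ e ∈ M, σ (en e).1 = σ (en e).2) (hC : ∀ e ∈ C, σ (en e).2 = -σ (en e).1)
    {ε : β ⊕ Fin n → ℤ} {h χ : β → ℤ}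
    (hh : ∀ i j, h ((Q i).edge j) = ε (Sum.inr i) * σ ((Q i).vert 0) * (-1) ^ (j : ℕ))
    (hhM : ∀ e ∈ M, h e = χ e) (hhC : ∀ e ∈ C, h e = ε (Sum.inl e) * σ (en e).1) (v : α) :
    (∑ j ∈ C.disjSum Finset.univ,
      ε j * (ind {v} (liftedEnds en Q j).1 - ind {v} (liftedEnds en Q j).2)) +
      ∑ e ∈ M, χ e * σ (en e).1 * (ind {v} (en e).1 + ind {v} (en e).2) =
    σ v * (∑ e ∈ FT, h e * incidence (en e) v + (∑ e ∈ M, h e * incidence (en e) v +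
      ∑ e ∈ C, h e * incidence (en e) v)) := by
  rw [mul_add, mul_add, sum_trail_signs hF hQ hσ hpar hh, Finset.sum_disjSum]
  have h1 : σ v * ∑ e ∈ M, h e * incidence (en e) v =
      ∑ e ∈ M, χ e * σ (en e).1 * (ind {v} (en e).1 + ind {v} (en e).2) := by
    rw [Finset.mul_sum]
    refine Finset.sum_congr rfl fun e he ↦ ?_
    have h2 := mul_ind_singleton σ v (en e).1
    have h3 := mul_ind_singleton σ v (en e).2
    rw [hhM e he, incidence]
    rw [← hM e he] at h3
    linear_combination χ e * h2 + χ e * h3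
  have h2 : σ v * ∑ e ∈ C, h e * incidence (en e) v =
      ∑ e ∈ C, ε (Sum.inl e) * (ind {v} (en e).1 - ind {v} (en e).2) := by
    rw [Finset.mul_sum]
    refine Finset.sum_congr rfl fun e he ↦ ?_
    have h2 := mul_ind_singleton σ v (en e).1
    have h3 := mul_ind_singleton σ v (en e).2
    have h4 : σ (en e).1 * σ (en e).1 = 1 := by rcases hσ (en e).1 with h | h <;> simp [h]
    rw [hhC e he, incidence]
    rw [hC e he] at h3
    linear_combination ε (Sum.inl e) * σ (en e).1 * h2 + ε (Sum.inl e) * σ (en e).1 * h3 +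
      ε (Sum.inl e) * (ind {v} (en e).1 - ind {v} (en e).2) * h4
  rw [h1, h2]
  simp only [liftedEnds, Sum.elim_inl, Sum.elim_inr]
  ring

end Trails

end FactorConstruction

/-! ### From orientations to factors with degrees prescribed modulo `k`. -/

section ModFactors

set_option linter.unusedSectionVars false

variable {α β : Type*} [DecidableEq α] [DecidableEq β]

theorem two_mul_sum_filter (E : Finset β) {h : β → ℤ} (hh : ∀ e, h e = 1 ∨ h e = -1) (φ : β → ℤ) :
    ∑ e ∈ E, h e * φ e = 2 * ∑ e ∈ E with h e = 1, φ e - ∑ e ∈ E, φ e := by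
  rw [Finset.sum_filter, Finset.mul_sum, ← Finset.sum_sub_distrib]
  refine Finset.sum_congr rfl fun e _ ↦ ?_
  rcases hh e with h | h <;> simp [h]
  ring

theorem sum_mul_incidence {W : Finset α} (σ : α → ℤ) {p : α × α} (h1 : p.1 ∈ W) (h2 : p.2 ∈ W) :
    ∑ v ∈ W, σ v * incidence p v = σ p.1 + σ p.2 := by
  have h : ∀ x ∈ W, ∑ v ∈ W, σ v * ind {v} x = σ x := fun x hx ↦ by
    simp [ind_eq, hx]
  simp only [incidence, mul_add, Finset.sum_add_distrib, h _ h1, h _ h2]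

/-- Signs of the edges of a graph, given as trails together with the edges `M` inside the two
classes of `σ` and the edges `C` between them, whose positive part has prescribed degrees. -/
theorem exists_balanced_signs {T : Graph α β} {E FT M C : Finset β} {en : β → α × α} {n : ℕ}
    {Q : Fin n → ModFactor.Trail T} {σ : α → ℤ} {W : Finset α} {k : ℕ} (hk : 2 ≤ k)
    (hF : HasEnds T FT en) (hQ : ModFactor.IsTrailDecomposition Q)
    (hσ : ∀ v, σ v = 1 ∨ σ v = -1)
    (hpar : ∀ i, σ ((Q i).vert 0) * σ ((Q i).vert (Fin.last _)) = (-1) ^ (Q i).size)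
    (hE : ∀ φ : β → ℤ, ∑ e ∈ E, φ e = ∑ e ∈ FT, φ e + (∑ e ∈ M, φ e + ∑ e ∈ C, φ e))
    (hMT : ∀ e ∈ M, e ∉ FT) (hCT : ∀ e ∈ C, e ∉ FT)
    (hM : ∀ e ∈ M, σ (en e).1 = σ (en e).2) (hC : ∀ e ∈ C, σ (en e).2 = -σ (en e).1)
    (hW : ∀ e, e ∈ FT ∨ e ∈ M ∨ e ∈ C → (en e).1 ∈ W ∧ (en e).2 ∈ W)
    (hQW : ∀ i j, (Q i).vert j ∈ W) {χ h₀ : β → ℤ} (hχ : ∀ e, χ e = 1 ∨ χ e = -1)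
    (hh₀ : ∀ i j, h₀ ((Q i).edge j) = σ ((Q i).vert 0) * (-1) ^ (j : ℕ)) {ft : α → ℤ}
    (hsum : (k : ℤ) ∣ ∑ v ∈ W, σ v * ft v -
      (∑ e ∈ FT with h₀ e = 1, (σ (en e).1 + σ (en e).2) +
        ∑ e ∈ M with χ e = 1, (σ (en e).1 + σ (en e).2)))
    (hcard : M.card ≤ k - 1)
    (hcut : ∀ A ⊆ W, A.Nonempty → A ≠ W → (3 * k - 3 : ℤ) ≤
      ∑ e ∈ M, |ind A (en e).1 - ind A (en e).2| + ∑ e ∈ C, |ind A (en e).1 - ind A (en e).2|)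
    {z : α} (hz : z ∈ W) :
    ∃ h : β → ℤ, (∀ e, h e = 1 ∨ h e = -1) ∧
      (∀ v ∈ W, (k : ℤ) ∣ ∑ e ∈ E with h e = 1, incidence (en e) v - ft v ∧
        |2 * ∑ e ∈ E with h e = 1, incidence (en e) v - ∑ e ∈ E, incidence (en e) v| ≤
          2 * k - 1) ∧
      2 * ∑ e ∈ E with h e = 1, incidence (en e) z - ∑ e ∈ E, incidence (en e) z ≠ 2 * k - 1 := by
  have hMC : ∀ e ∈ M, e ∉ C := fun e h1 h2 ↦ by
    have := hM e h1
    have := hC e h2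
    rcases hσ (en e).1 with h | h <;> omega
  have hs : ∀ e, χ e * σ (en e).1 = 1 ∨ χ e * σ (en e).1 = -1 := fun e ↦ by
    rcases hχ e with h | h <;> rcases hσ (en e).1 with h' | h' <;> simp [h, h']
  have hσσ : ∀ v, σ v * σ v = 1 := fun v ↦ by rcases hσ v with h | h <;> simp [h]
  set J : Finset (β ⊕ Fin n) := C.disjSum Finset.univ with hJ
  set le := liftedEnds en Q with hle
  let P : RootedGraph α := {
    verts := W
    edges := J.val.map fun j ↦ s((le j).1, (le j).2)
    inn := rootTails en M fun e ↦ -(χ e * σ (en e).1)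
    out := rootTails en M fun e ↦ χ e * σ (en e).1
    target := fun v ↦ σ v * (2 * ft v - ∑ e ∈ E, incidence (en e) v) }
  have hleW : ∀ j ∈ J, (le j).1 ∈ W ∧ (le j).2 ∈ W := by
    rintro (e | i) hj
    · exact hW e (Or.inr (Or.inr (by simpa [hJ] using hj)))
    · exact ⟨hQW _ _, hQW _ _⟩
  have hrdeg : ∀ A, P.rdeg A = ∑ e ∈ M, (ind A (en e).1 + ind A (en e).2) :=
    fun A ↦ mass_rootTails_add en M hs A
  have hrnet : ∀ A, P.rootNet A = ∑ e ∈ M, χ e * σ (en e).1 * (ind A (en e).1 + ind A (en e).2) :=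
    fun A ↦ mass_rootTails_sub en M hs A
  have hrdegW : P.rdeg W = 2 * M.card := by
    rw [hrdeg, Finset.sum_congr rfl fun e he ↦ by
      rw [ind_of_mem (hW e (Or.inr (Or.inl he))).1, ind_of_mem (hW e (Or.inr (Or.inl he))).2]]
    simp [mul_comm]
  have hrnet_sum : ∀ A, P.rootNet A = ∑ v ∈ A, P.rootNet {v} := fun A ↦ by
    simp only [RootedGraph.rootNet, Finset.sum_sub_distrib, ← mass_eq_sum]
  have key : ∀ ε : β ⊕ Fin n → ℤ, (∀ j, ε j = 1 ∨ ε j = -1) → ∃ h : β → ℤ,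
      (∀ e, h e = 1 ∨ h e = -1) ∧
      (∀ i j, h ((Q i).edge j) = ε (Sum.inr i) * σ ((Q i).vert 0) * (-1) ^ (j : ℕ)) ∧
      (∀ e ∈ M, h e = χ e) ∧ ∀ v,
        ∑ j ∈ J, ε j * (ind {v} (le j).1 - ind {v} (le j).2) + P.rootNet {v} =
          σ v * (2 * ∑ e ∈ E with h e = 1, incidence (en e) v - ∑ e ∈ E, incidence (en e) v) := by
    intro ε hε
    obtain ⟨hT, hhT⟩ := exists_trail_signs (σ := σ) hQ fun i ↦ ε (Sum.inr i)
    -- Only the orientation of trails and of edges between the classes is free; edges of `M` keep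
    -- the sign `χ`. The last branch also covers irrelevant edges, so that `h` is `±1` everywhere.
    let h : β → ℤ := fun e ↦
      if e ∈ FT then hT e else if e ∈ M then χ e else ε (Sum.inl e) * σ (en e).1
    have hedge : ∀ i j, (Q i).edge j ∈ FT := fun i j ↦ by
      rw [← Finset.mem_coe, hF.coe_eq]
      exact ((Q i).isLink j).edge_mem
    have h1 : ∀ i j, h ((Q i).edge j) = ε (Sum.inr i) * σ ((Q i).vert 0) * (-1) ^ (j : ℕ) :=
      fun i j ↦ by simp only [h, if_pos (hedge i j), hhT]
    have h2 : ∀ e ∈ M, h e = χ e := fun e he ↦ by simp only [h, if_neg (hMT e he), if_pos he]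
    have h3 : ∀ e ∈ C, h e = ε (Sum.inl e) * σ (en e).1 := fun e he ↦ by
      simp only [h, if_neg (hCT e he), if_neg fun h' ↦ hMC e h' he]
    have h4 : ∀ e, h e = 1 ∨ h e = -1 := by
      intro e
      by_cases he : e ∈ FT
      · obtain ⟨i, j, rfl⟩ := mem_trail hF hQ he
        rw [h1]
        rcases hε (Sum.inr i) with h | h <;> rcases hσ ((Q i).vert 0) with h' | h' <;>
          rcases neg_one_pow_eq_or ℤ (j : ℕ) with h'' | h'' <;> simp [h, h', h'']
      by_cases he' : e ∈ M
      · rw [h2 e he']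
        exact hχ e
      · simp only [h, if_neg he, if_neg he']
        rcases hε (Sum.inl e) with h | h <;> rcases hσ (en e).1 with h' | h' <;> simp [h, h']
    refine ⟨h, h4, h1, h2, fun v ↦ ?_⟩
    rw [hrnet, net_eq_balance hF hQ hσ hpar hM hC h1 h2 h3, ← hE, two_mul_sum_filter E h4]
  have hdeg : ∀ A, P.deg A = cut P.edges A + P.rdeg A := fun A ↦ add_assoc _ _ _
  -- A reference orientation: each demand differs from the reference net outdegree by an even
  -- number. This yields the parity condition, and the sum condition by comparing totals over `W`,
  -- where all arcs other than root arcs cancel.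
  obtain ⟨h, hh1, hhT, hhM, hhv⟩ := key (fun _ ↦ 1) fun _ ↦ Or.inl rfl
  have hD₀ : underlying (J.val.map le) = P.edges := by
    rw [underlying, Multiset.map_map]
    rfl
  have hnet₀ : ∀ A, net (J.val.map le) A = ∑ j ∈ J, 1 * (ind A (le j).1 - ind A (le j).2) := by
    intro A
    simp only [one_mul]
    unfold net
    rw [Multiset.map_map]
    rfl
  have hdem : ∀ A, P.demand A = net (J.val.map le) A + P.rootNet A +
      2 * (∑ v ∈ A, σ v * ft v - ∑ v ∈ A, σ v * ∑ e ∈ E with h e = 1, incidence (en e) v) := by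
    intro A
    rw [net_eq_sum, hrnet_sum, ← Finset.sum_add_distrib, ← Finset.sum_sub_distrib, Finset.mul_sum,
      ← Finset.sum_add_distrib]
    refine Finset.sum_congr rfl fun v _ ↦ ?_
    rw [hnet₀, hhv]
    change σ v * _ = _
    ring
  have hbal : ∑ v ∈ W, σ v * ∑ e ∈ E with h e = 1, incidence (en e) v =
      ∑ e ∈ FT with h₀ e = 1, (σ (en e).1 + σ (en e).2) +
        ∑ e ∈ M with χ e = 1, (σ (en e).1 + σ (en e).2) := by
    simp only [Finset.mul_sum, Finset.sum_filter]
    rw [Finset.sum_comm, hE]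
    have e1 : ∀ e, e ∈ FT ∨ e ∈ M ∨ e ∈ C →
        (∑ v ∈ W, σ v * if h e = 1 then incidence (en e) v else 0) =
          if h e = 1 then σ (en e).1 + σ (en e).2 else 0 := by
      intro e he
      split_ifs
      · exact sum_mul_incidence σ (hW e he).1 (hW e he).2
      · simp
    rw [Finset.sum_congr rfl fun e he ↦ e1 e (Or.inl he),
      Finset.sum_congr rfl fun e he ↦ e1 e (Or.inr (Or.inl he)),
      Finset.sum_congr rfl fun e he ↦ e1 e (Or.inr (Or.inr he))]
    have e2 : ∀ e ∈ FT, h e = h₀ e := fun e he ↦ by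
      obtain ⟨i, j, rfl⟩ := mem_trail hF hQ he
      rw [hhT, hh₀, one_mul]
    have e3 : ∑ e ∈ C, (if h e = 1 then σ (en e).1 + σ (en e).2 else 0) = 0 :=
      Finset.sum_eq_zero fun e he ↦ by simp [hC e he]
    rw [e3, add_zero]
    congr 1
    · exact Finset.sum_congr rfl fun e he ↦ by rw [e2 e he]
    · exact Finset.sum_congr rfl fun e he ↦ by rw [hhM e he]
  -- With `η = σ z` the excluded value becomes the upper extreme of `2 d_H(z) - d_G(z)`, whichever
  -- part contains `z`.
  have hmain := RootedGraph.exists_solution (P := P) hk hz (η := σ z) ?_ ?_ ?_ ?_ ?_ ?_ (hσ z)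
  · obtain ⟨D, hD, hDv, hDz⟩ := hmain
    obtain ⟨ε, hε, hεD⟩ := exists_sign le J D hD
    obtain ⟨h, hh1, -, -, hhv⟩ := key ε hε
    simp only [hεD, hhv] at hDv hDz
    refine ⟨h, hh1, fun v hv ↦ ⟨?_, ?_⟩, ?_⟩
    · obtain ⟨c, hc⟩ := (hDv v hv).1
      change σ v * _ - σ v * _ = _ at hc
      refine ⟨σ v * c, ?_⟩
      have h2 := hσσ v
      generalize ∑ e ∈ E with h e = 1, incidence (en e) v = d at hc ⊢
      have h3 : (2 : ℤ) * (d - ft v) = 2 * (k * (σ v * c)) := by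
        linear_combination σ v * hc - 2 * (d - ft v) * h2
      linarith
    · have := (hDv v hv).2
      rw [abs_mul] at this
      rcases hσ v with h | h <;> simpa [h] using this
    · rwa [← mul_assoc, hσσ, one_mul] at hDz
  · intro e he v hv
    obtain ⟨j, hj, rfl⟩ := Multiset.mem_map.1 he
    rcases Sym2.mem_iff.1 hv with rfl | rfl
    · exact (hleW j hj).1
    · exact (hleW j hj).2
  · intro A _
    have h1 := net_parity (J.val.map le) A
    rw [hD₀] at h1
    rw [hdem, hdeg, RootedGraph.rdeg, RootedGraph.rootNet]
    omega
  · have h1 : net (J.val.map le) W = 0 := by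
      refine net_eq_zero fun p hp ↦ ?_
      obtain ⟨j, hj, rfl⟩ := Multiset.mem_map.1 hp
      simp [hleW j hj]
    obtain ⟨c, hc⟩ := hsum
    refine ⟨c, ?_⟩
    change P.demand W - P.rootNet W = _
    rw [hdem, h1, hbal, hc]
    ring
  · rw [hrdegW]
    omega
  · exact ⟨_, hrdegW⟩
  · intro A hA hne hAW
    refine (hcut A hA hne hAW).trans ?_
    rw [hdeg, hrdeg, add_comm]
    have e1 : cut P.edges A = ∑ j ∈ J, |ind A (le j).1 - ind A (le j).2| := cut_map_val J _ A
    rw [e1, hJ, Finset.sum_disjSum]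
    refine add_le_add (le_add_of_nonneg_right (Finset.sum_nonneg fun i _ ↦ abs_nonneg _))
      (Finset.sum_le_sum fun e _ ↦ ?_)
    have h1 := ind_nonneg A (en e).1
    have h2 := ind_nonneg A (en e).2
    rw [abs_le]
    constructor <;> linarith

/-- A shift within a range of lengths at least `k - 1`, or an exact one. -/
theorem exists_shift {k : ℕ} (hk : 0 < k) {a b a' b' g c : ℤ}
    (haa : a ≤ a') (hbb : b ≤ b') (hab : a + b = min ((k : ℤ) - 1) (a' + b')) (hg1 : -b' ≤ g)
    (hg2 : g ≤ a') (hc : a + b = a' + b' → c = 0) :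
    ∃ t, -b ≤ t ∧ t ≤ a ∧ (k : ℤ) ∣ g - c - t := by
  by_cases h : a + b = a' + b'
  · exact ⟨g, by omega, by omega, by simp [hc h]⟩
  · have h1 := Int.emod_nonneg (g - c + b) (show (k : ℤ) ≠ 0 by omega)
    have h2 := Int.emod_lt_of_pos (g - c + b) (show (0 : ℤ) < k by omega)
    -- Here `a + b = k - 1`, so the interval from `-b` to `a` contains one representative of each
    -- residue.
    refine ⟨-b + (g - c + b) % k, by omega, by omega, ?_⟩
    have := Int.dvd_self_sub_emod (x := g - c + b) (m := k)
    convert this using 1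
    ring

theorem two_mul_sum_filter_eq {M : Finset β} {χ : β → ℤ} {en : β → α × α} {σ : α → ℤ}
    (hM : ∀ e ∈ M, σ (en e).1 = σ (en e).2) :
    ∑ e ∈ M with χ e = 1, (σ (en e).1 + σ (en e).2) =
      2 * ∑ e ∈ M, if χ e = 1 then σ (en e).1 else 0 := by
  rw [Finset.sum_filter, Finset.mul_sum]
  refine Finset.sum_congr rfl fun e he ↦ ?_
  rw [hM e he]
  split_ifs <;> ring

/-- Compatibility provides an integer in the range of the edges inside the two parts. -/
theorem exists_of_compatibleWith {G : Graph α β} {k : ℕ} [NeZero k] {f : α → ZMod k}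
    {X Y : Set α} {W : Finset α} (hXY : ModFactor.IsBipartition G X Y)
    (hW : (W : Set α) = G.vertexSet) (hf : ModFactor.CompatibleWith G k f X Y) {σ : α → ℤ}
    (hX : ∀ v ∈ X, σ v = 1) (hY : ∀ v ∈ Y, σ v = -1) :
    ∃ g : ℤ, -(ModFactor.edgesInside G Y : ℤ) ≤ g ∧ g ≤ ModFactor.edgesInside G X ∧
      (k : ℤ) ∣ ∑ v ∈ W, σ v * ((f v).val : ℤ) - 2 * g := by
  classical
  have hXW : X = ((W.filter (· ∈ X) : Finset α) : Set α) := by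
    ext v
    simp only [Finset.coe_filter, ← Finset.mem_coe, hW, ← hXY.union_eq, Set.mem_ofPred_eq]
    simp +contextual
  have hYW : Y = ((W.filter (· ∉ X) : Finset α) : Set α) := by
    ext v
    simp only [Finset.coe_filter, ← Finset.mem_coe, hW, ← hXY.union_eq, Set.mem_ofPred_eq,
      Set.mem_union]
    constructor
    · exact fun h ↦ ⟨Or.inr h, fun h' ↦ hXY.disjoint.le_bot ⟨h', h⟩⟩
    · exact fun h ↦ h.1.resolve_left h.2
  have key : ((∑ v ∈ W, σ v * ((f v).val : ℤ) : ℤ) : ZMod k) =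
      (∑ᶠ v ∈ X, f v) - ∑ᶠ v ∈ Y, f v := by
    have e1 : (∑ᶠ v ∈ X, f v) = ∑ v ∈ W with v ∈ X, f v := by
      rw [← finsum_mem_coe_finset, ← hXW]
    have e2 : (∑ᶠ v ∈ Y, f v) = ∑ v ∈ W with v ∉ X, f v := by
      rw [← finsum_mem_coe_finset, ← hYW]
    rw [e1, e2, ← Finset.sum_filter_add_sum_filter_not W (· ∈ X), Int.cast_add, sub_eq_add_neg]
    push_cast
    congr 1
    · refine Finset.sum_congr rfl fun v hv ↦ ?_
      rw [hX v (Finset.mem_filter.1 hv).2]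
      simp
    · rw [← Finset.sum_neg_distrib]
      refine Finset.sum_congr rfl fun v hv ↦ ?_
      rw [hY v (by rw [hYW]; exact hv)]
      simp
  rcases hf with ⟨x, hx, h⟩ | ⟨y, hy, h⟩
  · refine ⟨x, by omega, by exact_mod_cast hx, ?_⟩
    rw [← ZMod.intCast_zmod_eq_zero_iff_dvd, Int.cast_sub, key, ← h]
    push_cast
    ring
  · refine ⟨-y, by omega, by omega, ?_⟩
    rw [← ZMod.intCast_zmod_eq_zero_iff_dvd, Int.cast_sub, key, h]
    push_cast
    ring

/-- The degree bounds follow from a bound on twice the degree. -/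
theorem degree_bounds {d D k : ℕ} (h : |2 * (d : ℤ) - D| ≤ 2 * k - 1) :
    ⌊(D : ℚ) / 2⌋ - ((k : ℤ) - 1) ≤ d ∧ (d : ℤ) ≤ ⌈(D : ℚ) / 2⌉ + ((k : ℤ) - 1) := by
  rw [abs_le] at h
  have h1 := Int.floor_le ((D : ℚ) / 2)
  have h2 := Int.le_ceil ((D : ℚ) / 2)
  have h3 : (2 * ⌊(D : ℚ) / 2⌋ : ℤ) ≤ D := by
    have : (2 * ⌊(D : ℚ) / 2⌋ : ℚ) ≤ D := by linarith
    exact_mod_cast this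
  have h4 : (D : ℤ) ≤ 2 * ⌈(D : ℚ) / 2⌉ := by
    have : (D : ℚ) ≤ 2 * ⌈(D : ℚ) / 2⌉ := by linarith
    exact_mod_cast this
  omega

/-- For odd `D` the difference `2d - D` is odd, so missing the extreme `2k - 1` means at most `2k -
3`, one less in `d`. -/
theorem degree_bound_of_odd {d D k : ℕ} (hD : Odd D) (h : |2 * (d : ℤ) - D| ≤ 2 * k - 1)
    (hne : 2 * (d : ℤ) - D ≠ 2 * k - 1) : (d : ℤ) ≤ ⌈(D : ℚ) / 2⌉ + ((k : ℤ) - 1) - 1 := by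
  rw [abs_le] at h
  have h2 := Int.le_ceil ((D : ℚ) / 2)
  have h4 : (D : ℤ) ≤ 2 * ⌈(D : ℚ) / 2⌉ := by
    have : (D : ℚ) ≤ 2 * ⌈(D : ℚ) / 2⌉ := by linarith
    exact_mod_cast this
  obtain ⟨m, rfl⟩ := hD
  push_cast at *
  omega

section Parts

variable {G H : Graph α β} {F F' : Finset β} {en : β → α × α} {X Y : Set α} {σ : α → ℤ}

theorem edgesInside_left (hXY : ModFactor.IsBipartition G X Y) (hF : HasEnds G F en)
    (hX : ∀ v ∈ X, σ v = 1) (hY : ∀ v ∈ Y, σ v = -1) (hH : HasEnds H F' en) (hsub : F' ⊆ F) :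
    ModFactor.edgesInside H X =
      ((F'.filter fun e ↦ σ (en e).1 = σ (en e).2).filter fun e ↦ σ (en e).1 = 1).card := by
  classical
  rw [hH.edgesInside_eq, Finset.filter_filter]
  congr 1
  refine Finset.filter_congr fun e he ↦ ?_
  have h : ∀ v ∈ G.vertexSet, v ∈ X ↔ σ v = 1 := fun v hv ↦ by
    rw [← hXY.union_eq] at hv
    refine ⟨hX v, fun h1 ↦ hv.resolve_right fun h2 ↦ ?_⟩
    have := hY v h2
    omega
  have hl := hF.isLink e (hsub he)
  rw [h _ hl.left_mem, h _ hl.right_mem]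
  omega

theorem edgesInside_right (hXY : ModFactor.IsBipartition G X Y) (hF : HasEnds G F en)
    (hX : ∀ v ∈ X, σ v = 1) (hY : ∀ v ∈ Y, σ v = -1) (hH : HasEnds H F' en) (hsub : F' ⊆ F) :
    ModFactor.edgesInside H Y =
      ((F'.filter fun e ↦ σ (en e).1 = σ (en e).2).filter fun e ↦ σ (en e).1 = -1).card := by
  have h := edgesInside_left (σ := fun v ↦ -σ v)
    ⟨by rw [Set.union_comm, hXY.union_eq], hXY.disjoint.symm⟩ hF
    (fun v hv ↦ by simp [hY v hv]) (fun v hv ↦ by simp [hX v hv]) hH hsub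
  simpa only [neg_inj, neg_eq_iff_eq_neg (b := (1 : ℤ))] using h

theorem card_monochromatic (hXY : ModFactor.IsBipartition G X Y) (hF : HasEnds G F en)
    (hX : ∀ v ∈ X, σ v = 1) (hY : ∀ v ∈ Y, σ v = -1) (hH : HasEnds H F' en) (hsub : F' ⊆ F) :
    (F'.filter fun e ↦ σ (en e).1 = σ (en e).2).card =
      ModFactor.edgesInside H X + ModFactor.edgesInside H Y := by
  rw [edgesInside_left hXY hF hX hY hH hsub, edgesInside_right hXY hF hX hY hH hsub,
    ← Finset.card_filter_add_card_filter_not (fun e ↦ σ (en e).1 = 1)]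
  congr 2
  refine Finset.filter_congr fun e he ↦ ?_
  have h1 := (hF.isLink e (hsub (Finset.mem_filter.1 he).1)).left_mem
  rw [← hXY.union_eq] at h1
  rcases h1 with h1 | h1
  · simp [hX _ h1]
  · simp [hY _ h1]

end Parts

end ModFactors

/-! ### The factor with one excluded extreme degree, and the theorem. -/

theorem ModFactor.exists_factor {α β : Type*} {G T G₀ : Graph α β}
    (hV : G.vertexSet.Finite) (hE : G.edgeSet.Finite) {k : ℕ} (hk : 3 ≤ k) {f : α → ZMod k}
    (hf : ModFactor.Compatible G k f) {X Y : Set α} (hXY : ModFactor.IsBipartition G X Y)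
    (hdec : ModFactor.IsDecomposition G T G₀) (hT : ModFactor.HasParityTrailDecomposition T X)
    (hG₀ : ModFactor.edgesInside G₀ X + ModFactor.edgesInside G₀ Y =
      min (k - 1) (ModFactor.edgesInside G X + ModFactor.edgesInside G Y))
    (hconn : ModFactor.EdgeConnected G₀ (3 * k - 3)) {z : α} (hz : z ∈ G.vertexSet) :
    ∃ H : Graph α β, ModFactor.IsFactorMod H G k f ∧
      (∀ v ∈ G.vertexSet, |2 * (ModFactor.degree H v : ℤ) - ModFactor.degree G v| ≤ 2 * k - 1) ∧
      2 * (ModFactor.degree H z : ℤ) - ModFactor.degree G z ≠ 2 * k - 1 := by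
  classical
  have : Nonempty α := ⟨z⟩
  have : NeZero k := ⟨by omega⟩
  obtain ⟨F, en, hF⟩ := exists_hasEnds G hE
  obtain ⟨n, Q, hQ, hQX⟩ := hT
  set W := hV.toFinset with hWdef
  have hW : (W : Set α) = G.vertexSet := by simp [hWdef]
  set σ : α → ℤ := fun v ↦ if v ∈ X then 1 else -1 with hσdef
  have hσX : ∀ v ∈ X, σ v = 1 := fun v hv ↦ if_pos hv
  have hσn : ∀ v, v ∉ X → σ v = -1 := fun v hv ↦ if_neg hv
  have hσY : ∀ v ∈ Y, σ v = -1 := fun v hv ↦ hσn v fun h ↦ hXY.disjoint.le_bot ⟨h, hv⟩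
  have hσ : ∀ v, σ v = 1 ∨ σ v = -1 := fun v ↦ by
    by_cases h : v ∈ X
    · exact Or.inl (hσX v h)
    · exact Or.inr (hσn v h)
  have hpar : ∀ i, σ ((Q i).vert 0) * σ ((Q i).vert (Fin.last _)) = (-1) ^ (Q i).size := by
    intro i
    obtain ⟨h1, h2⟩ := hQX i
    rcases Nat.even_or_odd (Q i).size with h | h
    · rw [h.neg_one_pow]
      by_cases h3 : (Q i).vert 0 ∈ X
      · rw [hσX _ h3, hσX _ ((h2 h).1 h3), one_mul]
      · rw [hσn _ h3, hσn _ fun h4 ↦ h3 ((h2 h).2 h4)]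
        rfl
    · rw [h.neg_one_pow]
      rcases h1 h with ⟨h3, h4⟩ | ⟨h3, h4⟩
      · rw [hσX _ h3, hσn _ h4, one_mul]
      · rw [hσX _ h3, hσn _ h4, mul_one]
  set FT := F.filter (· ∈ T.edgeSet) with hFTdef
  set F₀ := F.filter (· ∉ T.edgeSet) with hF₀def
  have hFT : HasEnds T FT en := hF.mono hdec.left.le <| by
    ext e
    simp only [hFTdef, Finset.coe_filter, Set.mem_ofPred_eq, ← Finset.mem_coe, hF.coe_eq]
    exact ⟨fun h ↦ h.2, fun h ↦ ⟨hdec.left.le.edgeSet_mono h, h⟩⟩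
  have hF₀ : HasEnds G₀ F₀ en := hF.mono hdec.right.le <| by
    ext e
    simp only [hF₀def, Finset.coe_filter, Set.mem_ofPred_eq, ← Finset.mem_coe, hF.coe_eq,
      ← hdec.union_eq]
    exact ⟨fun h ↦ h.1.resolve_left h.2,
      fun h ↦ ⟨Or.inr h, fun h' ↦ hdec.disjoint.le_bot ⟨h', h⟩⟩⟩
  set M := F₀.filter (fun e ↦ σ (en e).1 = σ (en e).2) with hMdef
  set C := F₀.filter (fun e ↦ ¬σ (en e).1 = σ (en e).2) with hCdef
  have hMF : ∀ e ∈ M, e ∈ F₀ := fun e he ↦ (Finset.mem_filter.1 he).1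
  have hCF : ∀ e ∈ C, e ∈ F₀ := fun e he ↦ (Finset.mem_filter.1 he).1
  have hM : ∀ e ∈ M, σ (en e).1 = σ (en e).2 := fun e he ↦ (Finset.mem_filter.1 he).2
  have hC : ∀ e ∈ C, σ (en e).2 = -σ (en e).1 := fun e he ↦ by
    have h1 := (Finset.mem_filter.1 he).2
    rcases hσ (en e).1 with h | h <;> rcases hσ (en e).2 with h' | h' <;> simp_all
  have hsplit : ∀ φ : β → ℤ, ∑ e ∈ F, φ e = ∑ e ∈ FT, φ e + (∑ e ∈ M, φ e + ∑ e ∈ C, φ e) :=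
    fun φ ↦ by rw [Finset.sum_filter_add_sum_filter_not, Finset.sum_filter_add_sum_filter_not]
  have hends : ∀ e ∈ F, (en e).1 ∈ W ∧ (en e).2 ∈ W := fun e he ↦ by
    have := hF.isLink e he
    simp only [hWdef, Set.Finite.mem_toFinset]
    exact ⟨this.left_mem, this.right_mem⟩
  have hsub : F₀ ⊆ F := Finset.filter_subset _ _
  have hmX := edgesInside_left hXY hF hσX hσY hF₀ hsub
  have hmY := edgesInside_right hXY hF hσX hσY hF₀ hsub
  have hmM := card_monochromatic hXY hF hσX hσY hF₀ hsub
  rw [← hMdef] at hmM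
  have hGM := card_monochromatic hXY hF hσX hσY hF subset_rfl
  obtain ⟨g, hg1, hg2, hgk⟩ := exists_of_compatibleWith hXY hW (hf X Y hXY) hσX hσY
  obtain ⟨h₀, hh₀⟩ := exists_trail_signs (σ := σ) hQ fun _ ↦ 1
  simp only [one_mul] at hh₀
  -- Half the `σ`-weighted degree sum of the positive trail edges. Edges between the parts cancel,
  -- so the signs inside the parts of `G₀` must supply `g - c` modulo `k`.
  set c := ∑ e ∈ FT, if h₀ e = 1 ∧ σ (en e).1 = σ (en e).2 then σ (en e).1 else 0 with hc
  have hc2 : ∑ e ∈ FT with h₀ e = 1, (σ (en e).1 + σ (en e).2) = 2 * c := by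
    rw [Finset.sum_filter, hc, Finset.mul_sum]
    refine Finset.sum_congr rfl fun e _ ↦ ?_
    rcases hσ (en e).1 with h | h <;> rcases hσ (en e).2 with h' | h' <;> simp [h, h']
  -- If `G₀` contains every edge inside the parts, then `T` has none, and the trails contribute
  -- nothing. This is the case in which `t` cannot be shifted.
  have hc0 : M.card = (F.filter fun e ↦ σ (en e).1 = σ (en e).2).card → c = 0 := by
    intro h
    have h1 : M = F.filter fun e ↦ σ (en e).1 = σ (en e).2 :=
      Finset.eq_of_subset_of_card_le
        (Finset.filter_subset_filter _ (Finset.filter_subset _ _)) h.ge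
    refine Finset.sum_eq_zero fun e he ↦ if_neg fun h2 ↦ ?_
    have h3 : e ∈ M := by
      rw [h1]
      exact Finset.mem_filter.2 ⟨(Finset.mem_filter.1 he).1, h2.2⟩
    exact (Finset.mem_filter.1 (hMF e h3)).2 (Finset.mem_filter.1 he).2
  have hmono : ∀ A, ModFactor.edgesInside G₀ A ≤ ModFactor.edgesInside G A := fun A ↦ by
    rw [hF.edgesInside_eq, hF₀.edgesInside_eq]
    exact Finset.card_le_card (Finset.filter_subset_filter _ (Finset.filter_subset _ _))
  obtain ⟨t, ht1, ht2, htk⟩ := exists_shift (k := k) (by omega)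
    (a := ModFactor.edgesInside G₀ X) (b := ModFactor.edgesInside G₀ Y)
    (a' := ModFactor.edgesInside G X) (b' := ModFactor.edgesInside G Y) (g := g) (c := c)
    (by exact_mod_cast hmono X) (by exact_mod_cast hmono Y) (by omega) hg1 hg2
    (fun h ↦ hc0 (by omega))
  rw [hmY] at ht1
  rw [hmX] at ht2
  obtain ⟨χ, hχ, hχt⟩ := exists_signs_sum_eq M (s := fun e ↦ σ (en e).1) t ht1 ht2
  have hM2 := two_mul_sum_filter_eq (χ := χ) hM
  rw [hχt] at hM2
  obtain ⟨h, hh, hhv, hhz⟩ := exists_balanced_signs (E := F) (FT := FT) (M := M) (C := C) (W := W)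
    (z := z) (ft := fun v ↦ ((f v).val : ℤ)) (show 2 ≤ k by omega) hFT hQ hσ hpar hsplit
    (fun e he h ↦ (Finset.mem_filter.1 (hMF e he)).2 (Finset.mem_filter.1 h).2)
    (fun e he h ↦ (Finset.mem_filter.1 (hCF e he)).2 (Finset.mem_filter.1 h).2) hM hC
    (fun e he ↦ hends e <| by
      rcases he with he | he | he
      · exact (Finset.mem_filter.1 he).1
      · exact (Finset.mem_filter.1 (hMF e he)).1
      · exact (Finset.mem_filter.1 (hCF e he)).1)
    (fun i j ↦ by
      rw [← Finset.mem_coe, hW, ← hdec.left.vertexSet_eq]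
      exact (Q i).vert_mem j) hχ hh₀
    (by
      rw [hc2, hM2]
      obtain ⟨x, hx⟩ := hgk
      obtain ⟨y, hy⟩ := htk
      exact ⟨x + 2 * y, by linear_combination hx + 2 * hy⟩)
    (by omega)
    (fun A hA hne hAW ↦ by
      rw [Finset.sum_filter_add_sum_filter_not, ← hF₀.cutSize_eq]
      have h1 := hconn A hne <| by
        rw [hdec.right.vertexSet_eq, ← hW]
        exact_mod_cast hA.ssubset_of_ne hAW
      omega)
    (by simpa [hWdef] using hz)
  have hH : HasEnds (G.restrict (F.filter fun e ↦ h e = 1 : Finset β))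
      (F.filter fun e ↦ h e = 1) en := hF.mono Graph.restrict_le <| by
    refine (Set.inter_eq_right.2 ?_).symm
    rw [← hF.coe_eq]
    exact_mod_cast Finset.filter_subset _ _
  refine ⟨G.restrict (F.filter fun e ↦ h e = 1 : Finset β), ⟨⟨Graph.restrict_le, rfl⟩, fun v hv ↦ ?_⟩,
    fun v hv ↦ ?_, ?_⟩
  · have h1 := (hhv v (by simpa [hWdef] using hv)).1
    rw [← hH.degree_eq, ← ZMod.intCast_zmod_eq_zero_iff_dvd] at h1
    push_cast at h1
    rw [sub_eq_zero] at h1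
    simpa using h1
  · rw [hH.degree_eq, hF.degree_eq]
    exact (hhv v (by simpa [hWdef] using hv)).2
  · rwa [hH.degree_eq, hF.degree_eq]

theorem mainTheorem7 {α β : Type*} (G T G₀ : Graph α β)
    (hV : G.vertexSet.Finite) (hE : G.edgeSet.Finite)
    (k : ℕ) (hk : 3 ≤ k) (f : α → ZMod k) (hf : ModFactor.Compatible G k f)
    (X Y : Set α) (hXY : ModFactor.IsBipartition G X Y)
    (hdec : ModFactor.IsDecomposition G T G₀)
    (hT : ModFactor.HasParityTrailDecomposition T X)
    (hG₀ : ModFactor.edgesInside G₀ X + ModFactor.edgesInside G₀ Y =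
      min (k - 1) (ModFactor.edgesInside G X + ModFactor.edgesInside G Y))
    (hconn : ModFactor.EdgeConnected G₀ (3 * k - 3)) :
    (∃ H : Graph α β, ModFactor.IsFactorMod H G k f ∧
      ∀ v ∈ G.vertexSet,
        ⌊(ModFactor.degree G v : ℚ) / 2⌋ - ((k : ℤ) - 1) ≤ (ModFactor.degree H v : ℤ) ∧
        (ModFactor.degree H v : ℤ) ≤ ⌈(ModFactor.degree G v : ℚ) / 2⌉ + ((k : ℤ) - 1)) ∧
    (∀ z ∈ G.vertexSet, Odd (ModFactor.degree G z) →
      ∃ H : Graph α β, ModFactor.IsFactorMod H G k f ∧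
        (∀ v ∈ G.vertexSet,
          ⌊(ModFactor.degree G v : ℚ) / 2⌋ - ((k : ℤ) - 1) ≤ (ModFactor.degree H v : ℤ) ∧
          (ModFactor.degree H v : ℤ) ≤ ⌈(ModFactor.degree G v : ℚ) / 2⌉ + ((k : ℤ) - 1)) ∧
        (ModFactor.degree H z : ℤ) ≤ ⌈(ModFactor.degree G z : ℚ) / 2⌉ + ((k : ℤ) - 1) - 1) := by
  have key : ∀ z ∈ G.vertexSet, _ := fun z hz ↦
    ModFactor.exists_factor hV hE hk hf hXY hdec hT hG₀ hconn hz
  constructor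
  · rcases G.vertexSet.eq_empty_or_nonempty with h | ⟨z, hz⟩
    · exact ⟨G, ⟨.rfl, by simp [h]⟩, by simp [h]⟩
    · obtain ⟨H, h1, h2, -⟩ := key z hz
      exact ⟨H, h1, fun v hv ↦ degree_bounds (h2 v hv)⟩
  · intro z hz hodd
    obtain ⟨H, h1, h2, h3⟩ := key z hz
    exact ⟨H, h1, fun v hv ↦ degree_bounds (h2 v hv), degree_bound_of_odd hodd (h2 z hz) h3⟩
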